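/- Let $\Bbbk$ be a field and $z,t\in\Bbbk^\times$. The affine Kauffman category $\mathcal{AK}(z,t)$ is the strict $\Bbbk$-linear monoidal category generated by one object $\mathsf{go}$ and morphisms: a cap $\mathsf{go}^{\otimes2}\to\mathbf 1$, a cup $\mathbf 1\to\mathsf{go}^{\otimes 2}$, a positive and a negative crossing $\sigma^{\pm}\colon\mathsf{go}^{\otimes2}\to\mathsf{go}^{\otimes2}$, a dot $x\colon\mathsf{go}\to\mathsf{go}$ and $x^{-1}\colon\mathsf{go}\to\mathsf{go}$, subject to: $\sigma^+\sigma^-=1=\sigma^-\sigma^+$; the braid relation for $\sigma^+$; the two zigzag relations for cup and cap; $\mathrm{cap}\circ\sigma^-=t\,\mathrm{cap}$; $(1\otimes\mathrm{cap})(\sigma^-\otimes1)=(\mathrm{cap}\otimes1)(1\otimes\sigma^+)$; $\sigma^+-\sigma^-=z(1-\mathrm{cup}\circ\mathrm{cap})$; $\mathrm{cap}\circ\mathrm{cup}=\frac{t-t^{-1}}{z}+1$; $\sigma^-(x\otimes1)=(1\otimes x)\sigma^+$; $\mathrm{cap}(x\otimes1)=\mathrm{cap}(1\otimes x^{-1})$;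 $xx^{-1}=1=x^{-1}x$. Define the bubble generating series in $\operatorname{End}(\mathbf 1)[[u^{-1}]]$ $$\mathsf B^r(u)=\frac{(t^{-1}-z)u^2-t^{-1}}{u^2-zu-1}+\frac{z(u^2-1)}{u^2-zu-1}\sum_{n\ge0}u^{-n}\,\mathrm{cap}(1\otimes x^n)\mathrm{cup},\qquad \mathsf B^l(u)=\frac{(t+z)u^2-t}{u^2+zu-1}-\frac{z(u^2-1)}{u^2+zu-1}\sum_{n\ge0}u^{-n}\,\mathrm{cap}(x^n\otimes1)\mathrm{cup},$$ where rational functions are expanded at $u=\infty$. Let $\mathcal R$ be a $\Bbbk$-linear category with a $\Bbbk$-linear left action of $\mathcal{AK}(z,t)$ (a module category), and let $L\in\mathcal R$ be a brick, i.e. $\operatorname{End}_{\mathcal R}(L)=\Bbbk$. Let $\mathbb O^r_L(u),\mathbb O^l_L(u)\in\Bbbk[[u^{-1}]]$ be the series by which $\mathsf B^r(u)$, $\mathsf B^l(u)$ act on $L$, and let $J_L$ be the kernel of the homomorphism $\Bbbk[u,u^{-1}]\to\operatorname{End}_{\mathcal R}(\mathsf{go}L)$ sending $u$ to the action of the dot.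 For a monic $f\in\Bbbk[u]$ with $f(0)\neq0$ put $\check f(u)=f(0)^{-1}u^{\deg f}f(u^{-1})$ and $$\mathbb O^r_f(u)=\frac{tu^2-zf(0)u^{\varepsilon}-t}{u^2-zu-1}\cdot\frac{\check f(u)}{f(u)},\qquad \mathbb O^l_f(u)=\frac{t^{-1}u^2+zf(0)^{-1}u^{\varepsilon}-t^{-1}}{u^2+zu-1}\cdot\frac{f(u)}{\check f(u)},$$ where $\varepsilon=0$ if $\deg f$ is even and $\varepsilon=1$ if $\deg f$ is odd. (a) If $\operatorname{End}_{\mathcal R}(\mathsf{go}L)$ is finite dimensional, or $\operatorname{Hom}_{\mathcal R}(L,V)$ is finite dimensional for all $V\in\mathcal R$, then $J_L\neq0$. If $J_L\ne0$, then $J_L$ has a unique generator $m_L$ that is a monic polynomial in $\Bbbk[u]$ with $m_L(0)\neq0$. (b) Suppose $J_L\neq0$ and put $M=m_L(0)$. Then $\mathbb O^r_L(u)$ and $\mathbb O^l_L(u)$ are the expansions at $u=\infty$ of $\mathbb O^r_{m_L}(u)$ and $\mathbb O^l_{m_L}(u)$, respectively, and $\mathbb O^l_{m_L}(u)=\mathbb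 O^r_{m_L}(u^{-1})$ as rational functions. If $\deg m_L$ is even, then $z=t^{-1}M-tM^{-1}$; if $\deg m_L$ is odd, then $M=\pm t$. -/

import Mathlib

open CategoryTheory MonoidalCategory MonoidalLeftAction

universe u v w

/-! # The affine Kauffman category

`AK z t` is the strict `k`-linear monoidal category on one generating object, presented by
generating morphisms and relations.  Its objects are the tensor powers of the generating object,
i.e. natural numbers; its morphisms are formal linear/tensor/composition expressions in the
generators modulo the smallest congruence containing the axioms of a strict `k`-linear monoidal
category and the defining relations.  Diagrams are read from bottom to top, so
`comp f g` is `f` with `g` stacked on top of it. -/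

namespace AffineKauffman

/-- Formal morphism expressions. `pos` is the crossing in which the strand from bottom left to
top right passes over, `neg` the one in which it passes under. -/
inductive Term (k : Type u) : ℕ → ℕ → Type u
  | ident (a : ℕ) : Term k a a
  | comp {a b c : ℕ} (f : Term k a b) (g : Term k b c) : Term k a c
  | tens {a b c d : ℕ} (f : Term k a b) (g : Term k c d) : Term k (a + c) (b + d)
  | zero (a b : ℕ) : Term k a b
  | add {a b : ℕ} (f g : Term k a b) : Term k a b
  | smul {a b : ℕ} (r : k) (f : Term k a b) : Term k a b
  | cap : Term k 2 0
  | cup : Term k 0 2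
  | pos : Term k 2 2
  | neg : Term k 2 2
  | dot : Term k 1 1
  | dotInv : Term k 1 1

namespace Term

/-- The identity of `a`, regarded as a morphism `a ⟶ b` when `a = b`. -/
def ofEq (k : Type u) {a b : ℕ} (h : a = b) : Term k a b := h ▸ Term.ident a

end Term

open Term in
/-- The congruence generated by the axioms of a strict `k`-linear monoidal category and by the
defining relations of the affine Kauffman category. -/
inductive Rel {k : Type u} [CommRing k] (z t : kˣ) :
    ∀ {a b : ℕ}, Term k a b → Term k a b → Prop
  -- congruence
  | refl {a b} (f : Term k a b) : Rel z t f f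
  | symm {a b} {f g : Term k a b} : Rel z t f g → Rel z t g f
  | trans {a b} {f g h : Term k a b} : Rel z t f g → Rel z t g h → Rel z t f h
  | comp_congr {a b c} {f f' : Term k a b} {g g' : Term k b c} :
      Rel z t f f' → Rel z t g g' → Rel z t (comp f g) (comp f' g')
  | tensor_congr {a b c d} {f f' : Term k a b} {g g' : Term k c d} :
      Rel z t f f' → Rel z t g g' → Rel z t (tens f g) (tens f' g')
  | add_congr {a b} {f f' g g' : Term k a b} :
      Rel z t f f' → Rel z t g g' → Rel z t (add f g) (add f' g')
  | smul_congr {a b} (r : k) {f f' : Term k a b} :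
      Rel z t f f' → Rel z t (smul r f) (smul r f')
  -- category
  | id_comp {a b} (f : Term k a b) : Rel z t (comp (ident a) f) f
  | comp_id {a b} (f : Term k a b) : Rel z t (comp f (ident b)) f
  | comp_assoc {a b c d} (f : Term k a b) (g : Term k b c) (h : Term k c d) :
      Rel z t (comp (comp f g) h) (comp f (comp g h))
  -- morphism spaces are modules
  | add_assoc {a b} (f g h : Term k a b) : Rel z t (add (add f g) h) (add f (add g h))
  | add_comm {a b} (f g : Term k a b) : Rel z t (add f g) (add g f)
  | zero_add {a b} (f : Term k a b) : Rel z t (add (zero a b) f) f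
  | one_smul {a b} (f : Term k a b) : Rel z t (smul 1 f) f
  | zero_smul {a b} (f : Term k a b) : Rel z t (smul 0 f) (zero a b)
  | mul_smul {a b} (r s : k) (f : Term k a b) : Rel z t (smul (r * s) f) (smul r (smul s f))
  | smul_add {a b} (r : k) (f g : Term k a b) :
      Rel z t (smul r (add f g)) (add (smul r f) (smul r g))
  | add_smul {a b} (r s : k) (f : Term k a b) :
      Rel z t (smul (r + s) f) (add (smul r f) (smul s f))
  -- composition and tensor product are bilinear
  | add_comp {a b c} (f f' : Term k a b) (g : Term k b c) :
      Rel z t (comp (add f f') g) (add (comp f g) (comp f' g))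
  | comp_add {a b c} (f : Term k a b) (g g' : Term k b c) :
      Rel z t (comp f (add g g')) (add (comp f g) (comp f g'))
  | smul_comp {a b c} (r : k) (f : Term k a b) (g : Term k b c) :
      Rel z t (comp (smul r f) g) (smul r (comp f g))
  | comp_smul {a b c} (r : k) (f : Term k a b) (g : Term k b c) :
      Rel z t (comp f (smul r g)) (smul r (comp f g))
  | add_tensor {a b c d} (f f' : Term k a b) (g : Term k c d) :
      Rel z t (tens (add f f') g) (add (tens f g) (tens f' g))
  | tensor_add {a b c d} (f : Term k a b) (g g' : Term k c d) :
      Rel z t (tens f (add g g')) (add (tens f g) (tens f g'))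
  | smul_tensor {a b c d} (r : k) (f : Term k a b) (g : Term k c d) :
      Rel z t (tens (smul r f) g) (smul r (tens f g))
  | tensor_smul {a b c d} (r : k) (f : Term k a b) (g : Term k c d) :
      Rel z t (tens f (smul r g)) (smul r (tens f g))
  -- the tensor product is functorial, strictly associative and strictly unital
  | id_tensor_id (a b) : Rel z t (tens (ident a) (ident b)) (ident (a + b))
  | interchange {a b c a' b' c'} (f : Term k a b) (g : Term k b c)
      (f' : Term k a' b') (g' : Term k b' c') :
      Rel z t (comp (tens f f') (tens g g')) (tens (comp f g) (comp f' g'))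
  | tensor_assoc {a b c a' b' c'} (f : Term k a a') (g : Term k b b') (h : Term k c c') :
      Rel z t (comp (tens (tens f g) h) (ofEq k (Nat.add_assoc a' b' c')))
        (comp (ofEq k (Nat.add_assoc a b c)) (tens f (tens g h)))
  | id_zero_tensor {a b} (f : Term k a b) :
      Rel z t (comp (tens (ident 0) f) (ofEq k (Nat.zero_add b)))
        (comp (ofEq k (Nat.zero_add a)) f)
  | tensor_id_zero {a b} (f : Term k a b) :
      Rel z t (comp (tens f (ident 0)) (ofEq k (Nat.add_zero b)))
        (comp (ofEq k (Nat.add_zero a)) f)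
  -- the crossings are mutually inverse and satisfy the braid relation
  | pos_neg : Rel z t (comp pos neg) (ident 2)
  | neg_pos : Rel z t (comp neg pos) (ident 2)
  | braid : Rel z t (a := 3) (b := 3)
      (comp (b := 3) (tens pos (ident 1))
        (comp (b := 3) (tens (ident 1) pos) (tens pos (ident 1))))
      (comp (b := 3) (tens (ident 1) pos)
        (comp (b := 3) (tens pos (ident 1)) (tens (ident 1) pos)))
  -- zigzag relations
  | zigzag_left : Rel z t (comp (tens cup (ident 1)) (tens (ident 1) cap) : Term k 1 1) (ident 1)
  | zigzag_right : Rel z t (comp (tens (ident 1) cup) (tens cap (ident 1)) : Term k 1 1) (ident 1)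
  -- curl relation, and sliding a strand over a cap
  | curl : Rel z t (comp neg cap) (smul (t : k) cap)
  | slide : Rel z t (comp (tens neg (ident 1)) (tens (ident 1) cap) : Term k 3 1)
      (comp (tens (ident 1) pos) (tens cap (ident 1)) : Term k 3 1)
  -- Kauffman skein relation and the value of the bubble
  | skein : Rel z t (add pos (smul (-1) neg))
      (smul (z : k) (add (ident 2) (smul (-1) (comp cap cup))))
  | bubble : Rel z t (comp cup cap) (smul (((t : k) - (t⁻¹ : kˣ)) * (z⁻¹ : kˣ) + 1) (ident 0))
  -- dots
  | dot_cross : Rel z t (comp (tens dot (ident 1)) neg) (comp pos (tens (ident 1) dot))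
  | dot_cap : Rel z t (comp (tens dot (ident 1)) cap) (comp (tens (ident 1) dotInv) cap)
  | dot_dotInv : Rel z t (comp dot dotInv) (ident 1)
  | dotInv_dot : Rel z t (comp dotInv dot) (ident 1)

section Category

variable {k : Type u} [CommRing k] (z t : kˣ)

/-- The setoid whose quotient is a morphism space. -/
def termSetoid (a b : ℕ) : Setoid (Term k a b) where
  r := Rel z t
  iseqv := ⟨Rel.refl, Rel.symm, Rel.trans⟩

end Category

end AffineKauffman

open AffineKauffman

/-- The objects of the affine Kauffman category `AK(z,t)`: the object `⟨n⟩` is the `n`-th tensor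
power of the generating object. -/
structure AK {k : Type u} [CommRing k] (z t : kˣ) : Type where
  /-- The number of strands. -/
  strands : ℕ

namespace AK

variable {k : Type u} [CommRing k] {z t : kˣ}

/-- Morphisms of `AK(z,t)`: expressions modulo the relations. -/
def Hom (X Y : AK z t) : Type u := Quotient (termSetoid z t X.strands Y.strands)

/-- The morphism represented by an expression. -/
def ofTerm {a b : ℕ} (f : Term k a b) : Hom (⟨a⟩ : AK z t) ⟨b⟩ :=
  Quotient.mk (termSetoid z t a b) f

theorem ofTerm_eq {a b : ℕ} {f g : Term k a b} (h : Rel z t f g) :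
    (ofTerm f : Hom (⟨a⟩ : AK z t) ⟨b⟩) = ofTerm g := Quotient.sound h

instance : Category.{u} (AK z t) where
  Hom := Hom
  id X := ofTerm (Term.ident X.strands)
  comp := Quotient.map₂ Term.comp fun _ _ h _ _ h' => Rel.comp_congr h h'
  id_comp := by rintro _ _ ⟨f⟩; exact ofTerm_eq (Rel.id_comp f)
  comp_id := by rintro _ _ ⟨f⟩; exact ofTerm_eq (Rel.comp_id f)
  assoc := by rintro _ _ _ _ ⟨f⟩ ⟨g⟩ ⟨h⟩; exact ofTerm_eq (Rel.comp_assoc f g h)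

instance (X Y : AK z t) : Add (X ⟶ Y) where
  add := Quotient.map₂ Term.add fun _ _ h _ _ h' => Rel.add_congr h h'

instance (X Y : AK z t) : Zero (X ⟶ Y) where
  zero := ofTerm (Term.zero _ _)

instance (X Y : AK z t) : Neg (X ⟶ Y) where
  neg := Quotient.map (Term.smul (-1)) fun _ _ h => Rel.smul_congr _ h

instance (X Y : AK z t) : AddCommGroup (X ⟶ Y) where
  nsmul := nsmulRec
  zsmul := zsmulRec
  add_assoc := by rintro ⟨f⟩ ⟨g⟩ ⟨h⟩; exact ofTerm_eq (Rel.add_assoc f g h)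
  add_comm := by rintro ⟨f⟩ ⟨g⟩; exact ofTerm_eq (Rel.add_comm f g)
  zero_add := by rintro ⟨f⟩; exact ofTerm_eq (Rel.zero_add f)
  add_zero := by
    rintro ⟨f⟩; exact ofTerm_eq (Rel.trans (Rel.add_comm _ _) (Rel.zero_add f))
  neg_add_cancel := by
    rintro ⟨f⟩
    refine ofTerm_eq (Rel.trans (Rel.add_congr (Rel.refl _) (Rel.symm (Rel.one_smul f))) ?_)
    refine Rel.trans (Rel.symm (Rel.add_smul _ _ f)) ?_
    rw [neg_add_cancel]
    exact Rel.zero_smul f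

instance (X Y : AK z t) : Module k (X ⟶ Y) where
  smul r := Quotient.map (Term.smul r) fun _ _ h => Rel.smul_congr _ h
  one_smul := by rintro ⟨f⟩; exact ofTerm_eq (Rel.one_smul f)
  mul_smul := by rintro r s ⟨f⟩; exact ofTerm_eq (Rel.mul_smul r s f)
  smul_zero r := by
    refine ofTerm_eq (Rel.trans (Rel.smul_congr r (Rel.symm (Rel.zero_smul (Term.zero _ _)))) ?_)
    refine Rel.trans (Rel.symm (Rel.mul_smul _ _ _)) ?_
    rw [mul_zero]
    exact Rel.zero_smul _
  zero_smul := by rintro ⟨f⟩; exact ofTerm_eq (Rel.zero_smul f)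
  smul_add := by rintro r ⟨f⟩ ⟨g⟩; exact ofTerm_eq (Rel.smul_add r f g)
  add_smul := by rintro r s ⟨f⟩; exact ofTerm_eq (Rel.add_smul r s f)

instance : Preadditive (AK z t) where
  add_comp := by rintro _ _ _ ⟨f⟩ ⟨f'⟩ ⟨g⟩; exact ofTerm_eq (Rel.add_comp f f' g)
  comp_add := by rintro _ _ _ ⟨f⟩ ⟨g⟩ ⟨g'⟩; exact ofTerm_eq (Rel.comp_add f g g')

instance : Linear k (AK z t) where
  smul_comp := by rintro _ _ _ r ⟨f⟩ ⟨g⟩; exact ofTerm_eq (Rel.smul_comp r f g)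
  comp_smul := by rintro _ _ _ ⟨f⟩ r ⟨g⟩; exact ofTerm_eq (Rel.comp_smul r f g)

/-- The morphism represented by `ofEq`. -/
def isoOfEq {a b : ℕ} (h : a = b) : (⟨a⟩ : AK z t) ≅ ⟨b⟩ where
  hom := ofTerm (Term.ofEq k h)
  inv := ofTerm (Term.ofEq k h.symm)
  hom_inv_id := by subst h; exact ofTerm_eq (Rel.id_comp _)
  inv_hom_id := by subst h; exact ofTerm_eq (Rel.id_comp _)

theorem isoOfEq_comp {a b c : ℕ} (h : a = b) (h' : b = c) :
    (isoOfEq h : (⟨a⟩ : AK z t) ≅ ⟨b⟩).hom ≫ (isoOfEq h').hom = (isoOfEq (h.trans h')).hom := by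
  subst h h'; exact ofTerm_eq (Rel.id_comp _)

/-- The tensor product of objects is addition of numbers of strands, the tensor product of
morphisms is horizontal juxtaposition, and the associators and unitors are the identities coming
from the corresponding equalities of natural numbers. -/
instance : MonoidalCategoryStruct (AK z t) where
  tensorObj X Y := ⟨X.strands + Y.strands⟩
  tensorUnit := ⟨0⟩
  tensorHom := Quotient.map₂ Term.tens fun _ _ h _ _ h' => Rel.tensor_congr h h'
  whiskerLeft X _ _ := Quotient.map (Term.tens (Term.ident X.strands))
    fun _ _ h => Rel.tensor_congr (Rel.refl _) h
  whiskerRight f Y := Quotient.map (fun f => Term.tens f (Term.ident Y.strands))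
    (fun _ _ h => Rel.tensor_congr h (Rel.refl _)) f
  associator X Y Z := isoOfEq (Nat.add_assoc X.strands Y.strands Z.strands)
  leftUnitor X := isoOfEq (Nat.zero_add X.strands)
  rightUnitor X := isoOfEq (Nat.add_zero X.strands)

theorem isoOfEq_tensor_id {a b : ℕ} (h : a = b) (c : ℕ) :
    (isoOfEq h : (⟨a⟩ : AK z t) ≅ ⟨b⟩).hom ⊗ₘ 𝟙 (⟨c⟩ : AK z t) =
      (isoOfEq (congrArg (· + c) h)).hom := by
  subst h; exact ofTerm_eq (Rel.id_tensor_id _ _)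

theorem id_tensor_isoOfEq {a b : ℕ} (h : a = b) (c : ℕ) :
    𝟙 (⟨c⟩ : AK z t) ⊗ₘ (isoOfEq h : (⟨a⟩ : AK z t) ≅ ⟨b⟩).hom =
      (isoOfEq (congrArg (c + ·) h)).hom := by
  subst h; exact ofTerm_eq (Rel.id_tensor_id _ _)

instance : MonoidalCategory (AK z t) := MonoidalCategory.ofTensorHom
  (id_tensorHom_id := fun _ _ => ofTerm_eq (Rel.id_tensor_id _ _))
  (id_tensorHom := by rintro _ _ _ ⟨f⟩; rfl)
  (tensorHom_id := by rintro _ _ ⟨f⟩ _; rfl)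
  (tensorHom_comp_tensorHom := by
    rintro _ _ _ _ _ _ ⟨f⟩ ⟨f'⟩ ⟨g⟩ ⟨g'⟩; exact ofTerm_eq (Rel.interchange f g f' g'))
  (associator_naturality := by
    rintro _ _ _ _ _ _ ⟨f⟩ ⟨g⟩ ⟨h⟩; exact ofTerm_eq (Rel.tensor_assoc f g h))
  (leftUnitor_naturality := by rintro _ _ ⟨f⟩; exact ofTerm_eq (Rel.id_zero_tensor f))
  (rightUnitor_naturality := by rintro _ _ ⟨f⟩; exact ofTerm_eq (Rel.tensor_id_zero f))
  (pentagon := by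
    rintro ⟨a⟩ ⟨b⟩ ⟨c⟩ ⟨d⟩
    exact (congrArg₂ (· ≫ ·) (isoOfEq_tensor_id _ _)
      (congrArg₂ (· ≫ ·) rfl (id_tensor_isoOfEq _ _))).trans
      ((congrArg₂ (· ≫ ·) rfl (isoOfEq_comp _ _)).trans
        ((isoOfEq_comp _ _).trans (isoOfEq_comp _ _).symm)))
  (triangle := by
    rintro ⟨a⟩ ⟨b⟩
    exact (congrArg₂ (· ≫ ·) rfl (id_tensor_isoOfEq _ _)).trans
      ((isoOfEq_comp _ _).trans (isoOfEq_tensor_id _ _).symm))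

instance : MonoidalPreadditive (AK z t) where
  whiskerLeft_zero {X Y Z} := by
    refine ofTerm_eq (Rel.trans
      (Rel.tensor_congr (Rel.refl _) (Rel.symm (Rel.zero_smul (Term.zero _ _)))) ?_)
    exact Rel.trans (Rel.tensor_smul _ _ _) (Rel.zero_smul _)
  zero_whiskerRight {X Y Z} := by
    refine ofTerm_eq (Rel.trans
      (Rel.tensor_congr (Rel.symm (Rel.zero_smul (Term.zero _ _))) (Rel.refl _)) ?_)
    exact Rel.trans (Rel.smul_tensor _ _ _) (Rel.zero_smul _)
  whiskerLeft_add := by rintro _ _ _ ⟨f⟩ ⟨g⟩; exact ofTerm_eq (Rel.tensor_add _ f g)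
  add_whiskerRight := by rintro _ _ _ ⟨f⟩ ⟨g⟩; exact ofTerm_eq (Rel.add_tensor f g _)

instance : MonoidalLinear k (AK z t) where
  whiskerLeft_smul := by rintro _ _ _ r ⟨f⟩; exact ofTerm_eq (Rel.tensor_smul r _ f)
  smul_whiskerRight := by rintro r _ _ ⟨f⟩ _; exact ofTerm_eq (Rel.smul_tensor r f _)

variable (z t)

/-- The generating object. -/
def go : AK z t := ⟨1⟩

/-- The cap. -/
def cap : go z t ⊗ go z t ⟶ 𝟙_ (AK z t) := ofTerm Term.cap

/-- The cup. -/
def cup : 𝟙_ (AK z t) ⟶ go z t ⊗ go z t := ofTerm Term.cup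

/-- The dot, an invertible endomorphism of the generating object. -/
def dot : (End (go z t))ˣ where
  val := ofTerm Term.dot
  inv := ofTerm Term.dotInv
  val_inv := ofTerm_eq Rel.dotInv_dot
  inv_val := ofTerm_eq Rel.dot_dotInv

/-- The bubble with `n` dots on its right strand. -/
def bubbleR (n : ℕ) : End (𝟙_ (AK z t)) :=
  cup z t ≫ go z t ◁ ((dot z t : End (go z t)) ^ n : End (go z t)) ≫ cap z t

/-- The bubble with `n` dots on its left strand. -/
def bubbleL (n : ℕ) : End (𝟙_ (AK z t)) :=
  cup z t ≫ ((dot z t : End (go z t)) ^ n : End (go z t)) ▷ go z t ≫ cap z t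

end AK

/-! ### Bubble generating series

The variable `X` of all power and Laurent series below stands for `u⁻¹`. -/

section Series

open PowerSeries

variable {k : Type u} [Field k] (z t : kˣ)

/-- The series
`((t⁻¹ - z) u² - t⁻¹) / (u² - z u - 1) + z (u² - 1) / (u² - z u - 1) * ∑ₙ u⁻ⁿ (right bubble n)`,
where numerators and denominators have been divided by `u²`. -/
noncomputable def bubbleGenR : PowerSeries (End (𝟙_ (AK z t))) :=
  PowerSeries.map (algebraMap k (End (𝟙_ (AK z t))))
      ((C ((t : k)⁻¹ - z) - C (t : k)⁻¹ * X ^ 2) * (1 - C (z : k) * X - X ^ 2)⁻¹) +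
    PowerSeries.map (algebraMap k (End (𝟙_ (AK z t))))
      (C (z : k) * (1 - X ^ 2) * (1 - C (z : k) * X - X ^ 2)⁻¹) *
      PowerSeries.mk (AK.bubbleR z t)

/-- The series
`((t + z) u² - t) / (u² + z u - 1) - z (u² - 1) / (u² + z u - 1) * ∑ₙ u⁻ⁿ (left bubble n)`,
where numerators and denominators have been divided by `u²`. -/
noncomputable def bubbleGenL : PowerSeries (End (𝟙_ (AK z t))) :=
  PowerSeries.map (algebraMap k (End (𝟙_ (AK z t))))
      ((C ((t : k) + z) - C (t : k) * X ^ 2) * (1 + C (z : k) * X - X ^ 2)⁻¹) -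
    PowerSeries.map (algebraMap k (End (𝟙_ (AK z t))))
      (C (z : k) * (1 - X ^ 2) * (1 + C (z : k) * X - X ^ 2)⁻¹) *
      PowerSeries.mk (AK.bubbleL z t)

end Series

/-! ### Module categories -/

/-- A left action of a `k`-linear monoidal category `A` on a `k`-linear category `R` is `k`-linear
if every object of `A` acts by a `k`-linear functor and the action is `k`-linear on the morphisms
of `A`; equivalently, it is a `k`-linear monoidal functor from `A` to the `k`-linear endofunctors
of `R`. -/
class IsLinearAction (k : Type u) [CommRing k] (A : Type*) [Category* A] [Preadditive A]
    [Linear k A] [MonoidalCategory A] (R : Type*) [Category* R] [Preadditive R] [Linear k R]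
    [MonoidalLeftAction A R] : Prop where
  add_actionHomLeft {a b : A} (f g : a ⟶ b) (d : R) : (f + g) ⊵ₗ d = f ⊵ₗ d + g ⊵ₗ d
  smul_actionHomLeft {a b : A} (r : k) (f : a ⟶ b) (d : R) : (r • f) ⊵ₗ d = r • (f ⊵ₗ d)
  actionHomRight_add (a : A) {d e : R} (f g : d ⟶ e) : a ⊴ₗ (f + g) = a ⊴ₗ f + a ⊴ₗ g
  actionHomRight_smul (a : A) {d e : R} (r : k) (f : d ⟶ e) : a ⊴ₗ (r • f) = r • (a ⊴ₗ f)

/-- `L` is a brick: every endomorphism of `L` is multiplication by a unique scalar. -/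
def IsBrick (k : Type u) [Field k] {R : Type*} [Category* R] [Preadditive R] [Linear k R]
    (L : R) : Prop :=
  Function.Bijective (algebraMap k (End L))

/-- The scalar by which an endomorphism of a brick acts. -/
noncomputable def IsBrick.scalar {k : Type u} [Field k] {R : Type*} [Category* R] [Preadditive R]
    [Linear k R] {L : R} (hL : IsBrick k L) : End L ≃+* k :=
  (RingEquiv.ofBijective (algebraMap k (End L)) hL).symm

section Module

variable {k : Type u} [Field k] (z t : kˣ) {R : Type w} [Category.{v} R]
  [MonoidalLeftAction (AK z t) R]

/-- The action of an endomorphism of the unit object on an object `L` of a module category. -/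
def unitAct (L : R) (f : End (𝟙_ (AK z t))) : End L := (λₗ L).inv ≫ f ⊵ₗ L ≫ (λₗ L).hom

/-- The action of the dot on `go L`. -/
def dotAct (L : R) : (End (AK.go z t ⊙ₗ L))ˣ where
  val := (AK.dot z t : End (AK.go z t)) ⊵ₗ L
  inv := (↑(AK.dot z t)⁻¹ : End (AK.go z t)) ⊵ₗ L
  val_inv := by
    rw [End.mul_def, ← comp_actionHomLeft, ← End.mul_def, Units.mul_inv]
    exact id_actionHomLeft _ _
  inv_val := by
    rw [End.mul_def, ← comp_actionHomLeft, ← End.mul_def, Units.inv_mul]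
    exact id_actionHomLeft _ _

variable [Preadditive R] [Linear k R]

/-- The series in `u⁻¹` by which the right bubble generating series acts on a brick. -/
noncomputable def seriesR {L : R} (hL : IsBrick k L) : PowerSeries k :=
  PowerSeries.mk fun n => hL.scalar (unitAct z t L (PowerSeries.coeff n (bubbleGenR z t)))

/-- The series in `u⁻¹` by which the left bubble generating series acts on a brick. -/
noncomputable def seriesL {L : R} (hL : IsBrick k L) : PowerSeries k :=
  PowerSeries.mk fun n => hL.scalar (unitAct z t L (PowerSeries.coeff n (bubbleGenL z t)))

/-- The algebra homomorphism `k[u, u⁻¹] → End (go L)` sending `u` to the action of the dot. -/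
noncomputable def dotHom (L : R) : LaurentPolynomial k →ₐ[k] End (AK.go z t ⊙ₗ L) :=
  AddMonoidAlgebra.lift k (End (AK.go z t ⊙ₗ L)) ℤ
    ((Units.coeHom _).comp (zpowersHom _ (dotAct z t L)))

/-- The kernel of `dotHom`. -/
noncomputable def dotKernel (L : R) : Ideal (LaurentPolynomial k) :=
  RingHom.ker (dotHom z t L)

/-- `m` is the minimal polynomial of the invertible dot on `go L`: the generator of the kernel of
`k[u, u⁻¹] → End (go L)` which is a monic polynomial with nonzero constant term. -/
structure IsDotMinPoly (L : R) (m : Polynomial k) : Prop where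
  monic : m.Monic
  eval_zero_ne : m.eval 0 ≠ 0
  span_eq : dotKernel z t L = Ideal.span {Polynomial.toLaurent m}

end Module

/-! ### The rational functions attached to a polynomial -/

section Rational

variable {k : Type u} [Field k]

theorem transcendental_inv_X : Transcendental k (RatFunc.X⁻¹ : RatFunc k) := by
  intro h
  exact (RatFunc.transcendental_X (K := k)) (by simpa using h.inv)

/-- The substitution `u ↦ u⁻¹` on rational functions in `u`. -/
noncomputable def invVar : RatFunc k →ₐ[k] RatFunc k :=
  RatFunc.liftAlgHom (Polynomial.aeval (RatFunc.X⁻¹ : RatFunc k))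
    (nonZeroDivisors_le_comap_nonZeroDivisors_of_injective _
      (transcendental_iff_injective.mp transcendental_inv_X))

/-- The Laurent expansion at `u = ∞` of a rational function in `u`, as a Laurent series in the
variable `X = u⁻¹`. -/
noncomputable def expandInfty (f : RatFunc k) : LaurentSeries k :=
  ((invVar f : RatFunc k) : LaurentSeries k)

/-- The polynomial `f(0)⁻¹ u ^ (deg f) f(u⁻¹)`. -/
noncomputable def polyCheck (f : Polynomial k) : Polynomial k :=
  Polynomial.C (f.eval 0)⁻¹ * f.reverse

variable (z t : kˣ)

open Classical in
/-- The rational function `O^r_f(u)`, for `f` monic with `f(0) ≠ 0`. -/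
noncomputable def ratR (f : Polynomial k) : RatFunc k :=
  let u : RatFunc k := RatFunc.X
  let c : k → RatFunc k := RatFunc.C
  (if Even f.natDegree then
      (c t * u ^ 2 - c (z * f.eval 0) - c t) / (u ^ 2 - c z * u - 1)
    else
      (c t * u ^ 2 - c (z * f.eval 0) * u - c t) / (u ^ 2 - c z * u - 1)) *
    (algebraMap (Polynomial k) (RatFunc k) (polyCheck f) /
      algebraMap (Polynomial k) (RatFunc k) f)

open Classical in
/-- The rational function `O^l_f(u)`, for `f` monic with `f(0) ≠ 0`. -/
noncomputable def ratL (f : Polynomial k) : RatFunc k :=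
  let u : RatFunc k := RatFunc.X
  let c : k → RatFunc k := RatFunc.C
  (if Even f.natDegree then
      (c (t : k)⁻¹ * u ^ 2 + c (z * (f.eval 0)⁻¹) - c (t : k)⁻¹) / (u ^ 2 + c z * u - 1)
    else
      (c (t : k)⁻¹ * u ^ 2 + c (z * (f.eval 0)⁻¹) * u - c (t : k)⁻¹) / (u ^ 2 + c z * u - 1)) *
    (algebraMap (Polynomial k) (RatFunc k) f /
      algebraMap (Polynomial k) (RatFunc k) (polyCheck f))

end Rational

/-! Let `x` be the dot on `go L`, `d = deg m` and `ε = d % 2`. As `L` is a brick, closing `x ^ n` to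
a bubble around `L` gives scalars `a n` for all integers `n`. Right bubbles act by `a n`, and left
bubbles by `a (-n)`, because a dot becomes its inverse when it slides over a cap. The relation `m(x)
= 0` makes `a` linearly recurrent, so both generating series are rational, but their numerators
still involve the unknowns `a 0, ..., a (d - 1)` through `numerPoly` (`reverse_mul_mk`,
`mul_mk_neg`).

The unknowns are eliminated with a curl that carries an endomorphism `f` of `go L` on its inner
strand. The result is linear in `f` and equals `t⁻¹` for `f = 1`. Pulling a dot out of the curl
produces a factor `x⁻¹` and, by the skein relation, a correction `z (a - f)`, where `a` is the
bubble of `f` (`curlMap_dot_mul`). Hence the curl of `x ^ n` times `x ^ n` is an explicit polynomial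
in `x` (`curlMap_pow_mul`), and the curl of `m(x) = 0` shows that `m` divides `curlSum`.

Multiplied by `u² - 1`, this divisibility concerns `W = (t⁻¹(u² - 1) + z) m.reverse + z (u² - 1)
numerPoly`, which up to sign is the numerator of the right series in the variable `u⁻¹`: it gives `W
= m ((u² - 1) Y + z u ^ ε)`. Degrees force `Y` to be constant, and the top coefficient makes it `t⁻¹
m(0)` (`numer_eq`). Setting `u = 0` then yields the constraint on `m(0)` (`neg_eq_eval_zero_mul`),
which in turn gives the symmetry `u ↦ u⁻¹` between the two rational functions.

For the existence of `m`: self-duality of `go` embeds `End (go L)` into `Hom (L, go (go L))`, and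
the generator of the kernel is the minimal polynomial of `x`, whose constant term is nonzero because
`x` is invertible. -/

namespace AK

/-! ### Defining relations as equations between morphisms of `AK z t`. -/

section Relations

variable {k : Type u} [CommRing k] (z t : kˣ)

/-- The positive crossing. -/
def pos : go z t ⊗ go z t ⟶ go z t ⊗ go z t := ofTerm Term.pos

/-- The negative crossing. -/
def neg : go z t ⊗ go z t ⟶ go z t ⊗ go z t := ofTerm Term.neg

/-- The dot, as a morphism. -/
def dotMor : go z t ⟶ go z t := ofTerm Term.dot

/-- The inverse of the dot, as a morphism. -/
def dotInvMor : go z t ⟶ go z t := ofTerm Term.dotInv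

theorem neg_cap : neg z t ≫ cap z t = (t : k) • cap z t := ofTerm_eq Rel.curl

theorem pos_sub_neg :
    pos z t + (-1 : k) • neg z t = (z : k) • (𝟙 _ + (-1 : k) • (cap z t ≫ cup z t)) :=
  ofTerm_eq Rel.skein

theorem cup_cap :
    cup z t ≫ cap z t = (((t : k) - (t⁻¹ : kˣ)) * (z⁻¹ : kˣ) + 1) • 𝟙 (𝟙_ (AK z t)) :=
  ofTerm_eq Rel.bubble

instance : IsIso (dotMor z t) :=
  ⟨dotInvMor z t, ofTerm_eq Rel.dot_dotInv, ofTerm_eq Rel.dotInv_dot⟩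

theorem dot_neg : dotMor z t ▷ go z t ≫ neg z t = pos z t ≫ go z t ◁ dotMor z t :=
  ofTerm_eq Rel.dot_cross

theorem dot_cap : dotMor z t ▷ go z t ≫ cap z t = go z t ◁ dotInvMor z t ≫ cap z t :=
  ofTerm_eq Rel.dot_cap

theorem zigzag_left : cup z t ▷ go z t ≫ (α_ (go z t) (go z t) (go z t)).hom ≫
    go z t ◁ cap z t = (λ_ (go z t)).hom ≫ (ρ_ (go z t)).inv := by
  refine ofTerm_eq (Rel.trans (Rel.comp_congr (Rel.refl _) (Rel.id_comp _)) ?_)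
  exact Rel.trans Rel.zigzag_left (Rel.symm (Rel.id_comp _))

theorem zigzag_right : go z t ◁ cup z t ≫ (α_ (go z t) (go z t) (go z t)).inv ≫
    cap z t ▷ go z t = (ρ_ (go z t)).hom ≫ (λ_ (go z t)).inv := by
  refine ofTerm_eq (Rel.trans (Rel.comp_congr (Rel.refl _) (Rel.id_comp _)) ?_)
  exact Rel.trans Rel.zigzag_right (Rel.symm (Rel.id_comp _))

theorem neg_slide : neg z t ▷ go z t ≫ (α_ (go z t) (go z t) (go z t)).hom ≫ go z t ◁ cap z t ≫
      (ρ_ (go z t)).hom =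
    (α_ (go z t) (go z t) (go z t)).hom ≫ go z t ◁ pos z t ≫
      (α_ (go z t) (go z t) (go z t)).inv ≫ cap z t ▷ go z t ≫ (λ_ (go z t)).hom := by
  refine ofTerm_eq (Rel.trans (Rel.comp_congr (Rel.refl _)
    (Rel.trans (Rel.id_comp _) (Rel.comp_id _))) ?_)
  refine Rel.trans Rel.slide (Rel.symm (Rel.trans (Rel.id_comp _) ?_))
  exact Rel.comp_congr (Rel.refl _) (Rel.trans (Rel.id_comp _) (Rel.comp_id _))

end Relations

/-! ### Cups, caps, crossings and dots acting on a module category. -/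

section Action

variable {k : Type u} [Field k] (z t : kˣ) {R : Type w} [Category.{v} R]
  [MonoidalLeftAction (AK z t) R]

/-- The cap, acting between `go (go V)` and `V`. -/
def capAct (V : R) : go z t ⊙ₗ go z t ⊙ₗ V ⟶ V :=
  (αₗ (go z t) (go z t) V).inv ≫ cap z t ⊵ₗ V ≫ (λₗ V).hom

/-- The cup, acting between `V` and `go (go V)`. -/
def cupAct (V : R) : V ⟶ go z t ⊙ₗ go z t ⊙ₗ V :=
  (λₗ V).inv ≫ cup z t ⊵ₗ V ≫ (αₗ (go z t) (go z t) V).hom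

/-- The action of an endomorphism of `go ⊗ go` on `go (go V)`. -/
def crossAct (s : go z t ⊗ go z t ⟶ go z t ⊗ go z t) (V : R) :
    go z t ⊙ₗ go z t ⊙ₗ V ⟶ go z t ⊙ₗ go z t ⊙ₗ V :=
  (αₗ (go z t) (go z t) V).inv ≫ s ⊵ₗ V ≫ (αₗ (go z t) (go z t) V).hom

variable {V W : R}

theorem capAct_naturality (f : V ⟶ W) :
    capAct z t V ≫ f = go z t ⊴ₗ go z t ⊴ₗ f ≫ capAct z t W := by
  have h := action_exchange (cap z t) f
  have h2 := actionUnitIso_hom_naturality (C := AK z t) f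
  rw [tensor_actionHomRight] at h
  simp only [capAct, Category.assoc]
  rw [h2, ← reassoc_of% h]
  simp only [Iso.inv_hom_id_assoc]

theorem cupAct_naturality (f : V ⟶ W) :
    f ≫ cupAct z t W = cupAct z t V ≫ go z t ⊴ₗ go z t ⊴ₗ f := by
  have h := action_exchange (cup z t) f
  have h2 := actionUnitIso_inv_naturality (C := AK z t) f
  rw [tensor_actionHomRight] at h
  simp only [cupAct, Category.assoc]
  rw [← reassoc_of% h2, reassoc_of% h]
  simp only [Iso.inv_hom_id, Category.comp_id]

theorem cupAct_naturality_assoc (f : V ⟶ W) {Z : R} (h : go z t ⊙ₗ go z t ⊙ₗ W ⟶ Z) :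
    f ≫ cupAct z t W ≫ h = cupAct z t V ≫ go z t ⊴ₗ go z t ⊴ₗ f ≫ h :=
  (reassoc_of% (cupAct_naturality z t f)) h

theorem crossAct_naturality (s : go z t ⊗ go z t ⟶ go z t ⊗ go z t) (f : V ⟶ W) :
    crossAct z t s V ≫ go z t ⊴ₗ go z t ⊴ₗ f = go z t ⊴ₗ go z t ⊴ₗ f ≫ crossAct z t s W := by
  have h := action_exchange s f
  rw [tensor_actionHomRight] at h
  simp only [crossAct, Category.assoc]
  rw [← cancel_mono (αₗ (go z t) (go z t) W).inv, ← cancel_epi (αₗ (go z t) (go z t) V).hom]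
  simpa using h.symm

theorem crossAct_naturality_assoc (s : go z t ⊗ go z t ⟶ go z t ⊗ go z t) (f : V ⟶ W) {Z : R}
    (h : go z t ⊙ₗ go z t ⊙ₗ W ⟶ Z) :
    crossAct z t s V ≫ go z t ⊴ₗ go z t ⊴ₗ f ≫ h =
      go z t ⊴ₗ go z t ⊴ₗ f ≫ crossAct z t s W ≫ h :=
  (reassoc_of% (crossAct_naturality z t s f)) h

/-- The action on `R` need not be strict. This lemma and the next three rewrite the structure
isomorphisms of `AK z t` through those of the action, so that diagrammatic relations can be
transported to `R`. -/
theorem associator_hom_act (V : R) : (α_ (go z t) (go z t) (go z t)).hom ⊵ₗ V =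
    (αₗ (go z t ⊗ go z t) (go z t) V).hom ≫ (αₗ (go z t) (go z t) (go z t ⊙ₗ V)).hom ≫
      go z t ⊴ₗ (αₗ (go z t) (go z t) V).inv ≫ (αₗ (go z t) (go z t ⊗ go z t) V).inv := by
  rw [← associator_actionHom_assoc]
  simp

theorem associator_inv_act (V : R) : (α_ (go z t) (go z t) (go z t)).inv ⊵ₗ V =
    (αₗ (go z t) (go z t ⊗ go z t) V).hom ≫ go z t ⊴ₗ (αₗ (go z t) (go z t) V).hom ≫
      (αₗ (go z t) (go z t) (go z t ⊙ₗ V)).inv ≫ (αₗ (go z t ⊗ go z t) (go z t) V).inv := by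
  rw [← cancel_epi ((α_ (go z t) (go z t) (go z t)).hom ⊵ₗ V), hom_inv_actionHomLeft,
    associator_hom_act]
  simp

theorem leftUnitor_inv_act (V : R) : (λ_ (go z t)).inv ⊵ₗ V =
    (λₗ (go z t ⊙ₗ V)).inv ≫ (αₗ (𝟙_ (AK z t)) (go z t) V).inv := by
  rw [← cancel_epi ((λ_ (go z t)).hom ⊵ₗ V), hom_inv_actionHomLeft, leftUnitor_actionHom]
  simp

theorem rightUnitor_inv_act (V : R) : (ρ_ (go z t)).inv ⊵ₗ V =
    go z t ⊴ₗ (λₗ V).inv ≫ (αₗ (go z t) (𝟙_ (AK z t)) V).inv := by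
  rw [← cancel_epi ((ρ_ (go z t)).hom ⊵ₗ V), hom_inv_actionHomLeft, rightUnitor_actionHom]
  simp

theorem cupAct_zigzag (V : R) :
    cupAct z t (go z t ⊙ₗ V) ≫ go z t ⊴ₗ capAct z t V = 𝟙 _ := by
  have h := congrArg (· ⊵ₗ V) (zigzag_left z t)
  simp only [comp_actionHomLeft, whiskerRight_actionHomLeft, whiskerLeft_actionHomLeft,
    associator_hom_act, rightUnitor_inv_act, leftUnitor_actionHom, Category.assoc,
    Iso.inv_hom_id_assoc, cancel_epi] at h
  rw [← cancel_epi (λₗ[AK z t] (go z t ⊙ₗ V)).hom, ← cancel_mono (go z t ⊴ₗ (λₗ[AK z t] V).inv),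
    ← cancel_mono (αₗ (go z t) (𝟙_ (AK z t)) V).inv]
  simpa only [cupAct, capAct, actionHomRight_comp, Category.assoc, Iso.hom_inv_id_assoc,
    actionHomRight_hom_inv, actionHomRight_hom_inv_assoc, Category.comp_id] using h

theorem zigzag_capAct (V : R) :
    go z t ⊴ₗ cupAct z t V ≫ capAct z t (go z t ⊙ₗ V) = 𝟙 _ := by
  have h := congrArg (· ⊵ₗ V) (zigzag_right z t)
  simp only [comp_actionHomLeft, whiskerRight_actionHomLeft, whiskerLeft_actionHomLeft,
    associator_inv_act, leftUnitor_inv_act, rightUnitor_actionHom, Category.assoc,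
    Iso.inv_hom_id_assoc, cancel_epi] at h
  rw [← cancel_epi (go z t ⊴ₗ (λₗ[AK z t] V).hom), ← cancel_mono (λₗ[AK z t] (go z t ⊙ₗ V)).inv,
    ← cancel_mono (αₗ (𝟙_ (AK z t)) (go z t) V).inv]
  simpa only [cupAct, capAct, actionHomRight_comp, Category.assoc, Iso.hom_inv_id_assoc,
    actionHomRight_hom_inv, actionHomRight_hom_inv_assoc, Category.comp_id] using h

theorem zigzag_capAct_assoc (V : R) {Z : R} (h : go z t ⊙ₗ V ⟶ Z) :
    go z t ⊴ₗ cupAct z t V ≫ capAct z t (go z t ⊙ₗ V) ≫ h = h :=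
  (reassoc_of% (zigzag_capAct z t V)) h

theorem neg_slide_act (V : R) :
    crossAct z t (neg z t) (go z t ⊙ₗ V) ≫ go z t ⊴ₗ capAct z t V =
      go z t ⊴ₗ crossAct z t (pos z t) V ≫ capAct z t (go z t ⊙ₗ V) := by
  have h := congrArg (· ⊵ₗ V) (neg_slide z t)
  simp only [comp_actionHomLeft, whiskerRight_actionHomLeft, whiskerLeft_actionHomLeft,
    associator_inv_act, associator_hom_act, leftUnitor_actionHom, rightUnitor_actionHom,
    Category.assoc, Iso.inv_hom_id_assoc, cancel_epi] at h
  rw [← cancel_epi (αₗ (go z t) (go z t) (go z t ⊙ₗ V)).hom]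
  simpa only [crossAct, capAct, actionHomRight_comp, Category.assoc, Iso.hom_inv_id_assoc,
    actionHomRight_hom_inv, actionHomRight_hom_inv_assoc, Category.comp_id] using h

theorem dot_neg_act (V : R) :
    dotMor z t ⊵ₗ (go z t ⊙ₗ V) ≫ crossAct z t (neg z t) V =
      crossAct z t (pos z t) V ≫ go z t ⊴ₗ (dotMor z t ⊵ₗ V) := by
  have h := congrArg (· ⊵ₗ V) (dot_neg z t)
  simp only [comp_actionHomLeft, whiskerRight_actionHomLeft, whiskerLeft_actionHomLeft,
    Category.assoc] at h
  rw [← cancel_epi (αₗ (go z t) (go z t) V).hom, ← cancel_mono (αₗ (go z t) (go z t) V).inv]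
  simpa only [crossAct, Category.assoc, Iso.hom_inv_id_assoc, Iso.hom_inv_id,
    Category.comp_id] using h

theorem dot_neg_act_assoc (V : R) {Z : R} (h : go z t ⊙ₗ go z t ⊙ₗ V ⟶ Z) :
    dotMor z t ⊵ₗ (go z t ⊙ₗ V) ≫ crossAct z t (neg z t) V ≫ h =
      crossAct z t (pos z t) V ≫ go z t ⊴ₗ (dotMor z t ⊵ₗ V) ≫ h :=
  (reassoc_of% (dot_neg_act z t V)) h

theorem dot_cap_act (V : R) :
    dotMor z t ⊵ₗ (go z t ⊙ₗ V) ≫ capAct z t V =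
      go z t ⊴ₗ (dotInvMor z t ⊵ₗ V) ≫ capAct z t V := by
  have h := congrArg (· ⊵ₗ V) (dot_cap z t)
  simp only [comp_actionHomLeft, whiskerRight_actionHomLeft, whiskerLeft_actionHomLeft,
    Category.assoc] at h
  rw [← cancel_epi (αₗ (go z t) (go z t) V).hom, ← cancel_mono (λₗ[AK z t] V).inv]
  simpa only [capAct, Category.assoc, Iso.hom_inv_id_assoc, Iso.hom_inv_id,
    Category.comp_id] using h

theorem dotMor_dotInvMor_act (V : R) : dotMor z t ⊵ₗ V ≫ dotInvMor z t ⊵ₗ V = 𝟙 _ := by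
  rw [← comp_actionHomLeft, show dotMor z t ≫ dotInvMor z t = 𝟙 _ from ofTerm_eq Rel.dot_dotInv,
    id_actionHomLeft]

theorem dotMor_dotInvMor_act_assoc (V : R) {Z : R} (h : go z t ⊙ₗ V ⟶ Z) :
    dotMor z t ⊵ₗ V ≫ dotInvMor z t ⊵ₗ V ≫ h = h :=
  (reassoc_of% (dotMor_dotInvMor_act z t V)) h

theorem dotInv_cap_act (V : R) :
    go z t ⊴ₗ (dotMor z t ⊵ₗ V) ≫ capAct z t V =
      dotInvMor z t ⊵ₗ (go z t ⊙ₗ V) ≫ capAct z t V := by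
  rw [← cancel_epi (dotMor z t ⊵ₗ (go z t ⊙ₗ V)), dotMor_dotInvMor_act_assoc,
    ← action_exchange_assoc, dot_cap_act, ← Category.assoc, ← actionHomRight_comp,
    dotMor_dotInvMor_act, actionHomRight_id, Category.id_comp]

theorem neg_dotInv_act (V : R) :
    crossAct z t (neg z t) V ≫ go z t ⊴ₗ (dotInvMor z t ⊵ₗ V) =
      dotInvMor z t ⊵ₗ (go z t ⊙ₗ V) ≫ crossAct z t (pos z t) V := by
  rw [← cancel_epi (dotMor z t ⊵ₗ (go z t ⊙ₗ V)), dotMor_dotInvMor_act_assoc,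
    dot_neg_act_assoc, ← actionHomRight_comp, dotMor_dotInvMor_act, actionHomRight_id,
    Category.comp_id]

theorem neg_dotInv_act_assoc (V : R) {Z : R} (h : go z t ⊙ₗ go z t ⊙ₗ V ⟶ Z) :
    crossAct z t (neg z t) V ≫ go z t ⊴ₗ (dotInvMor z t ⊵ₗ V) ≫ h =
      dotInvMor z t ⊵ₗ (go z t ⊙ₗ V) ≫ crossAct z t (pos z t) V ≫ h :=
  (reassoc_of% (neg_dotInv_act z t V)) h

/-- The mate of `neg_slide_act` under the self-duality of `go`: sliding over a cap becomes sliding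
over a cup. -/
theorem cup_slide_act (V : R) :
    go z t ⊴ₗ cupAct z t V ≫ crossAct z t (pos z t) (go z t ⊙ₗ V) =
      cupAct z t (go z t ⊙ₗ V) ≫ go z t ⊴ₗ crossAct z t (neg z t) V := by
  -- Bending one leg of `neg_slide_act` with a cup exhibits the positive crossing as a rotated
  -- negative one.
  have h : ∀ W : R, crossAct z t (pos z t) W = cupAct z t (go z t ⊙ₗ go z t ⊙ₗ W) ≫
      go z t ⊴ₗ (crossAct z t (neg z t) (go z t ⊙ₗ W) ≫ go z t ⊴ₗ capAct z t W) := by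
    intro W
    rw [neg_slide_act, actionHomRight_comp, ← cupAct_naturality_assoc, cupAct_zigzag,
      Category.comp_id]
  rw [h, cupAct_naturality_assoc, ← actionHomRight_comp, ← crossAct_naturality_assoc,
    ← actionHomRight_comp, zigzag_capAct, actionHomRight_id, Category.comp_id]

variable [Preadditive R] [Linear k R] [IsLinearAction k (AK z t) R]

theorem pos_act (V : R) : crossAct z t (pos z t) V = crossAct z t (neg z t) V +
    (z : k) • (𝟙 _ - capAct z t V ≫ cupAct z t V) := by
  have h := congrArg (· ⊵ₗ V) (pos_sub_neg z t)
  simp only [IsLinearAction.add_actionHomLeft (k := k), IsLinearAction.smul_actionHomLeft (k := k),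
    comp_actionHomLeft, id_actionHomLeft] at h
  rw [neg_smul, one_smul, neg_smul, one_smul, ← sub_eq_add_neg, ← sub_eq_add_neg,
    sub_eq_iff_eq_add'] at h
  simp only [crossAct, h, capAct, cupAct, Preadditive.comp_add, Preadditive.add_comp,
    Linear.comp_smul, Linear.smul_comp, Preadditive.comp_sub, Preadditive.sub_comp,
    Category.id_comp, Category.assoc, Iso.inv_hom_id, Iso.hom_inv_id_assoc]

theorem neg_cap_act (V : R) :
    crossAct z t (neg z t) V ≫ capAct z t V = (t : k) • capAct z t V := by
  have h := congrArg (· ⊵ₗ V) (neg_cap z t)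
  simp only [IsLinearAction.smul_actionHomLeft (k := k), comp_actionHomLeft] at h
  simp only [crossAct, capAct, Category.assoc, Iso.hom_inv_id_assoc, reassoc_of% h,
    Linear.comp_smul, Linear.smul_comp]

theorem cup_cap_act (V : R) :
    cupAct z t V ≫ capAct z t V = (((t : k) - (t : k)⁻¹) * (z : k)⁻¹ + 1) • 𝟙 V := by
  have h := congrArg (· ⊵ₗ V) (cup_cap z t)
  simp only [IsLinearAction.smul_actionHomLeft (k := k), comp_actionHomLeft,
    id_actionHomLeft] at h
  simp only [cupAct, capAct, Category.assoc, Iso.hom_inv_id_assoc, reassoc_of% h,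
    Linear.comp_smul, Linear.smul_comp, Category.id_comp, Iso.inv_hom_id, Units.val_inv_eq_inv_val]

end Action

end AK

namespace AK

/-! ### Dotted bubbles and dotted curls. -/

section Bubbles

variable {k : Type u} [Field k] (z t : kˣ) {R : Type w} [Category.{v} R]
  [MonoidalLeftAction (AK z t) R]

theorem dotAct_inv_naturality_assoc {V W : R} (f : V ⟶ W) {Z : R} (h : go z t ⊙ₗ W ⟶ Z) :
    go z t ⊴ₗ f ≫ dotInvMor z t ⊵ₗ W ≫ h = dotInvMor z t ⊵ₗ V ≫ go z t ⊴ₗ f ≫ h :=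
  action_exchange_assoc _ _ _

theorem dot_pow_act (V : R) (n : ℕ) :
    ((dot z t : End (go z t)) ^ n : End (go z t)) ⊵ₗ V = (dotAct z t V : End (go z t ⊙ₗ V)) ^ n := by
  induction n with
  | zero => exact id_actionHomLeft _ _
  | succ n ih =>
    rw [pow_succ, pow_succ, End.mul_def, End.mul_def, comp_actionHomLeft, ih]
    rfl

/-- This turns dots on the left strand of a bubble into inverse dots on the right strand, so left
bubbles are bubbles of nonpositive index. -/
theorem dotInv_pow_cap (V : R) (n : ℕ) :
    ((dotAct z t (go z t ⊙ₗ V) : End _) ^ n : End (go z t ⊙ₗ go z t ⊙ₗ V)) ≫ capAct z t V =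
      go z t ⊴ₗ ((↑(dotAct z t V)⁻¹ : End _) ^ n : End (go z t ⊙ₗ V)) ≫ capAct z t V := by
  induction n with
  | zero =>
    rw [pow_zero, pow_zero, End.one_def, End.one_def, actionHomRight_id]
  | succ n ih =>
    rw [pow_succ', pow_succ, End.mul_def, End.mul_def, actionHomRight_comp, Category.assoc,
      Category.assoc, ← ih]
    change _ ≫ dotMor z t ⊵ₗ _ ≫ _ = go z t ⊴ₗ (dotInvMor z t ⊵ₗ V) ≫ _ ≫ _
    rw [dot_cap_act, ← dot_pow_act, action_exchange_assoc]

theorem unitAct_bubbleR (L : R) (n : ℕ) : unitAct z t L (bubbleR z t n) =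
    cupAct z t L ≫ go z t ⊴ₗ ((dotAct z t L : End _) ^ n : End (go z t ⊙ₗ L)) ≫
      capAct z t L := by
  rw [← dot_pow_act]
  simp only [unitAct, bubbleR, cupAct, capAct, comp_actionHomLeft, whiskerLeft_actionHomLeft,
    Category.assoc]

theorem unitAct_bubbleL (L : R) (n : ℕ) : unitAct z t L (bubbleL z t n) =
    cupAct z t L ≫ go z t ⊴ₗ ((↑(dotAct z t L)⁻¹ : End _) ^ n : End (go z t ⊙ₗ L)) ≫
      capAct z t L := by
  rw [← dotInv_pow_cap, ← dot_pow_act]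
  simp only [unitAct, bubbleL, cupAct, capAct, comp_actionHomLeft, whiskerRight_actionHomLeft,
    Category.assoc]

variable [Preadditive R] [Linear k R] [IsLinearAction k (AK z t) R]

/-- Closing an endomorphism of `go L` to a bubble. -/
def bubbleMap (L : R) : End (go z t ⊙ₗ L) →ₗ[k] End L where
  toFun f := cupAct z t L ≫ go z t ⊴ₗ f ≫ capAct z t L
  map_add' f g := by
    rw [IsLinearAction.actionHomRight_add k, Preadditive.add_comp, Preadditive.comp_add]
  map_smul' r f := by
    rw [IsLinearAction.actionHomRight_smul, Linear.smul_comp, Linear.comp_smul, RingHom.id_apply]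

/-- Putting an endomorphism of `go L` on the innermost strand of a curl. -/
def curlMap (L : R) : End (go z t ⊙ₗ L) →ₗ[k] End (go z t ⊙ₗ L) where
  toFun f := go z t ⊴ₗ cupAct z t L ≫ crossAct z t (neg z t) (go z t ⊙ₗ L) ≫
    go z t ⊴ₗ go z t ⊴ₗ f ≫ go z t ⊴ₗ capAct z t L
  map_add' f g := by
    rw [IsLinearAction.actionHomRight_add k, IsLinearAction.actionHomRight_add k,
      Preadditive.add_comp, Preadditive.comp_add, Preadditive.comp_add]
  map_smul' r f := by
    rw [IsLinearAction.actionHomRight_smul, IsLinearAction.actionHomRight_smul,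
      Linear.smul_comp, Linear.comp_smul, Linear.comp_smul, RingHom.id_apply]

/-- Capping off `cup_slide_act` gives `t` on one side by the curl relation. On the other side the
skein relation gives the present curl plus `z (c - 1)`, with `c` the value of the bubble; and `t - z
(c - 1) = t⁻¹`. -/
theorem curlMap_one (L : R) : curlMap z t L 1 = (t : k)⁻¹ • (1 : End (go z t ⊙ₗ L)) := by
  have h := congrArg (· ≫ go z t ⊴ₗ capAct z t L) (cup_slide_act z t L)
  simp only [Category.assoc, pos_act, ← actionHomRight_comp, neg_cap_act,
    Preadditive.add_comp, Preadditive.comp_add, Preadditive.sub_comp, Preadditive.comp_sub,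
    Linear.smul_comp, Linear.comp_smul, Category.id_comp, zigzag_capAct_assoc,
    cupAct_zigzag, cup_cap_act, IsLinearAction.actionHomRight_smul (k := k),
    actionHomRight_id] at h
  have h1 : curlMap z t L 1 = go z t ⊴ₗ cupAct z t L ≫ crossAct z t (neg z t) (go z t ⊙ₗ L) ≫
      go z t ⊴ₗ capAct z t L := by
    change _ ≫ _ ≫ go z t ⊴ₗ go z t ⊴ₗ 𝟙 _ ≫ _ = _
    rw [actionHomRight_id, actionHomRight_id, Category.id_comp]
  have hc : (t : k)⁻¹ = t - z * ((((t : k) - (t : k)⁻¹) * (z : k)⁻¹ + 1) - 1) := by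
    have hz : (z : k) ≠ 0 := z.ne_zero
    field_simp
    ring
  generalize ((t : k) - (t : k)⁻¹) * (z : k)⁻¹ + 1 = c at h hc
  rw [h1, End.one_def, eq_sub_of_add_eq h, hc]
  module

/-- The dot slides over the cap and becomes inverse, passes the crossing, which turns positive, and
leaves at the bottom. The skein relation restores the negative crossing. Its identity term closes
`f` to the bubble `a`, and its cup-cap term straightens to `f` by the zigzags. -/
theorem curl_dot_act {L : R} (f : go z t ⊙ₗ L ⟶ go z t ⊙ₗ L) {a : k}
    (ha : cupAct z t L ≫ go z t ⊴ₗ f ≫ capAct z t L = a • 𝟙 L) :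
    go z t ⊴ₗ cupAct z t L ≫ crossAct z t (neg z t) (go z t ⊙ₗ L) ≫
      go z t ⊴ₗ go z t ⊴ₗ (f ≫ dotMor z t ⊵ₗ L) ≫ go z t ⊴ₗ capAct z t L =
    dotInvMor z t ⊵ₗ L ≫ (go z t ⊴ₗ cupAct z t L ≫ crossAct z t (neg z t) (go z t ⊙ₗ L) ≫
      go z t ⊴ₗ go z t ⊴ₗ f ≫ go z t ⊴ₗ capAct z t L + (z : k) • (a • 𝟙 _ - f)) := by
  have h1 : go z t ⊴ₗ go z t ⊴ₗ (f ≫ dotMor z t ⊵ₗ L) ≫ go z t ⊴ₗ capAct z t L =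
      go z t ⊴ₗ (dotInvMor z t ⊵ₗ (go z t ⊙ₗ L)) ≫
        go z t ⊴ₗ go z t ⊴ₗ f ≫ go z t ⊴ₗ capAct z t L := by
    simp only [← actionHomRight_comp (go z t)]
    rw [actionHomRight_comp (go z t) f, Category.assoc, dotInv_cap_act, dotAct_inv_naturality_assoc]
  have h2 : go z t ⊴ₗ cupAct z t L ≫ go z t ⊴ₗ go z t ⊴ₗ f ≫ go z t ⊴ₗ capAct z t L =
      a • 𝟙 _ := by
    simp only [← actionHomRight_comp]
    rw [ha, IsLinearAction.actionHomRight_smul, actionHomRight_id]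
  rw [h1, neg_dotInv_act_assoc, dotAct_inv_naturality_assoc, pos_act]
  congr 1
  simp only [Preadditive.add_comp, Preadditive.sub_comp,
    Preadditive.comp_add, Preadditive.comp_sub, Linear.smul_comp, Linear.comp_smul,
    Category.id_comp, Category.assoc,
    zigzag_capAct_assoc, ← cupAct_naturality_assoc, cupAct_zigzag, Category.comp_id, h2]

theorem curlMap_dot_mul (L : R) (f : End (go z t ⊙ₗ L)) {a : k}
    (ha : bubbleMap z t L f = a • 1) :
    curlMap z t L (dotAct z t L * f) =
      (curlMap z t L f + (z : k) • (a • 1 - f)) * (↑(dotAct z t L)⁻¹ : End (go z t ⊙ₗ L)) :=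
  curl_dot_act z t f ha

end Bubbles

end AK

/-! ### Polynomial and power series identities for a linearly recurrent sequence. -/

section BubblePolynomials

open Polynomial Finset

variable {k : Type u} [Field k]

/-- The polynomial `∑ᵢ mᵢ u ^ (d - i) ∑_{j < i} aⱼ u ^ j`, with `d` the degree of `m`. -/
noncomputable def numerPoly (a : ℤ → k) (m : k[X]) : k[X] :=
  ∑ i ∈ range (m.natDegree + 1),
    C (m.coeff i) * X ^ (m.natDegree - i) * ∑ j ∈ range i, C (a j) * X ^ j

/-- The polynomial `p` such that the curl with `n` dots on its inner strand is `u⁻ⁿ p`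
evaluated at the dot. -/
noncomputable def curlPoly (z t : k) (a : ℤ → k) (n : ℕ) : k[X] :=
  C t⁻¹ + C z * ∑ j ∈ range n, (C (a j) * X ^ j - X ^ (2 * j))

/-- The linear combination of the curl polynomials with the coefficients of `m`. -/
noncomputable def curlSum (z t : k) (a : ℤ → k) (m : k[X]) : k[X] :=
  ∑ i ∈ range (m.natDegree + 1),
    C (m.coeff i) * X ^ (m.natDegree - i) * curlPoly z t a i

theorem reflect_sum_C_mul_X_pow {ι : Type*} (N : ℕ) (s : Finset ι) (c : ι → k) (e : ι → ℕ) :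
    reflect N (∑ i ∈ s, C (c i) * X ^ e i) = ∑ i ∈ s, C (c i) * X ^ (revAt N (e i)) := by
  induction s using Finset.cons_induction with
  | empty => simp
  | cons i s hi ih => rw [sum_cons, sum_cons, reflect_add, ih, reflect_C_mul_X_pow]

theorem reverse_eq_sum (m : k[X]) :
    m.reverse = ∑ i ∈ range (m.natDegree + 1), C (m.coeff i) * X ^ (m.natDegree - i) := by
  have h := reflect_sum_C_mul_X_pow m.natDegree (range (m.natDegree + 1)) m.coeff id
  simp only [id, ← m.as_sum_range_C_mul_X_pow] at h
  rw [reverse, h]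
  refine sum_congr rfl fun i hi => ?_
  rw [revAt_le (by simpa [Nat.lt_succ_iff] using hi)]

/-- The factor `X ^ 2 - 1` telescopes the geometric sum of the `X ^ (2 * j)`. -/
theorem sq_sub_one_mul_curlPoly (z t : k) (a : ℤ → k) (n : ℕ) :
    (X ^ 2 - 1) * curlPoly z t a n = (C t⁻¹ * (X ^ 2 - 1) + C z) +
      C z * (X ^ 2 - 1) * ∑ j ∈ range n, C (a j) * X ^ j - C z * X ^ (2 * n) := by
  have h := mul_geom_sum (X ^ 2 : k[X]) n
  simp only [← pow_mul] at h
  rw [curlPoly, sum_sub_distrib]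
  linear_combination -C z * h

/-- The last term comes from `u ^ (d - i) * u ^ (2 * i) = u ^ d * u ^ i`. It is a multiple of `m`,
so divisibility of `curlSum` passes to the other two terms. -/
theorem sq_sub_one_mul_curlSum (z t : k) (a : ℤ → k) (m : k[X]) :
    (X ^ 2 - 1) * curlSum z t a m = (C t⁻¹ * (X ^ 2 - 1) + C z) * m.reverse +
      C z * (X ^ 2 - 1) * numerPoly a m - C z * X ^ m.natDegree * m := by
  have h : C z * X ^ m.natDegree * m = ∑ i ∈ range (m.natDegree + 1),
      C z * (C (m.coeff i) * X ^ (m.natDegree - i) * X ^ (2 * i)) := by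
    conv_lhs => enter [2]; rw [m.as_sum_range_C_mul_X_pow]
    rw [mul_sum]
    refine sum_congr rfl fun i hi => ?_
    obtain ⟨j, hj⟩ := Nat.exists_eq_add_of_le (Nat.lt_succ_iff.mp (mem_range.mp hi))
    rw [hj, Nat.add_sub_cancel_left]
    ring
  rw [h, reverse_eq_sum, numerPoly, curlSum, mul_sum, mul_sum, mul_sum, ← sum_add_distrib,
    ← sum_sub_distrib]
  refine sum_congr rfl fun i _ => ?_
  linear_combination (C (m.coeff i) * X ^ (m.natDegree - i)) * sq_sub_one_mul_curlPoly z t a i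

theorem natDegree_numerPoly_le (a : ℤ → k) (m : k[X]) : (numerPoly a m).natDegree ≤ m.natDegree := by
  refine natDegree_sum_le_of_forall_le _ _ fun i hi => ?_
  rw [mul_sum]
  refine natDegree_sum_le_of_forall_le _ _ fun j hj => ?_
  have h : C (m.coeff i) * X ^ (m.natDegree - i) * (C (a j) * X ^ j) =
      C (m.coeff i * a j) * X ^ (m.natDegree - i + j) := by
    rw [C_mul, pow_add]; ring
  rw [h]
  refine (natDegree_C_mul_X_pow_le _ _).trans ?_
  rw [mem_range] at hi hj
  omega

theorem coeff_numerPoly_natDegree (a : ℤ → k) (m : k[X]) :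
    (numerPoly a m).coeff m.natDegree = 0 := by
  rw [numerPoly, finsetSum_coeff]
  refine sum_eq_zero fun i hi => ?_
  have h : m.natDegree = i + (m.natDegree - i) := by
    rw [mem_range] at hi
    omega
  rw [mul_assoc, mul_comm (X ^ _), coeff_C_mul]
  nth_rw 2 [h]
  rw [coeff_mul_X_pow, finsetSum_coeff, sum_eq_zero, mul_zero]
  intro j hj
  rw [coeff_C_mul_X_pow, if_neg (mem_range.mp hj).ne']

/-- This is the source of the parity exponent `ε`: modulo `u² - 1`, only the parity of `d` matters.
-/
theorem sq_sub_one_dvd_X_pow (d : ℕ) : (X ^ 2 - 1 : k[X]) ∣ X ^ d - X ^ (d % 2) := by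
  have h : (X ^ d - X ^ (d % 2) : k[X]) = X ^ (d % 2) * ((X ^ 2) ^ (d / 2) - 1 ^ (d / 2)) := by
    rw [← pow_mul, one_pow, mul_sub, ← pow_add, Nat.mod_add_div, mul_one]
  rw [h]
  exact (sub_dvd_pow_sub_pow _ _ _).mul_left _

/-- The bubble numerator factors through `m` once `m` divides the combination of curls. -/
theorem exists_numer_eq (z : k) {t : k} (a : ℤ → k) {m : k[X]} (hm : m.Monic)
    (hdvd : m ∣ curlSum z t a m) :
    ∃ h : k, (C t⁻¹ * (X ^ 2 - 1) + C z) * m.reverse + C z * (X ^ 2 - 1) * numerPoly a m =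
      m * (C h * (X ^ 2 - 1) + C z * X ^ (m.natDegree % 2)) := by
  obtain ⟨H, hH⟩ := hdvd
  obtain ⟨Q, hQ⟩ := sq_sub_one_dvd_X_pow (k := k) m.natDegree
  have key := sq_sub_one_mul_curlSum z t a m
  set W := (C t⁻¹ * (X ^ 2 - 1) + C z) * m.reverse + C z * (X ^ 2 - 1) * numerPoly a m with hW
  have hWm : W = m * ((X ^ 2 - 1) * (H + C z * Q) + C z * X ^ (m.natDegree % 2)) := by
    linear_combination -key + (X ^ 2 - 1) * hH + C z * m * hQ
  -- The degree bound is what pins down the unknown cofactor.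
  have hWdeg : W.natDegree ≤ m.natDegree + 2 := by
    have h1 := natDegree_numerPoly_le a m
    have h2 := m.reverse_natDegree_le
    rw [hW]
    refine natDegree_add_le_of_degree_le ?_ ?_
    · rw [add_comm m.natDegree]
      refine natDegree_mul_le_of_le ?_ h2
      compute_degree
    · rw [add_comm m.natDegree]
      refine natDegree_mul_le_of_le ?_ h1
      compute_degree
  -- A nonconstant cofactor would give degree at least `d + 3`; the term `z u ^ ε` has degree at
  -- most 1 and cannot cancel the top term.
  have hY : (H + C z * Q).natDegree = 0 := by
    by_contra hne
    have hX : (X ^ 2 - 1 : k[X]).Monic := monic_X_pow_sub_C 1 two_ne_zero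
    have hX2 : (X ^ 2 - 1 : k[X]).natDegree = 2 := natDegree_X_pow_sub_C (r := 1)
    have hlt : (C z * X ^ (m.natDegree % 2)).natDegree <
        ((X ^ 2 - 1) * (H + C z * Q)).natDegree := by
      rw [hX.natDegree_mul' (by rintro h0; simp [h0] at hne), hX2]
      have := natDegree_C_mul_X_pow_le z (m.natDegree % 2)
      omega
    have h3 := natDegree_add_eq_left_of_natDegree_lt hlt
    rw [hX.natDegree_mul' (by rintro h0; simp [h0] at hne), hX2] at h3
    rw [hWm, hm.natDegree_mul' (by rintro h0; rw [h0, natDegree_zero] at h3; omega), h3] at hWdeg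
    omega
  obtain ⟨h, hh⟩ := natDegree_eq_zero.mp hY
  exact ⟨h, by rw [hWm, ← hh]; ring⟩

/-- The free constant is the coefficient of degree `d + 2`. There `numerPoly` contributes nothing,
since its coefficient of degree `d` vanishes, and `m.reverse` contributes `m(0)`. The right side no
longer involves `a`. -/
theorem numer_eq {z t : k} {a : ℤ → k} {m : k[X]} (hm : m.Monic)
    (hdvd : m ∣ curlSum z t a m) :
    (C t⁻¹ * (X ^ 2 - 1) + C z) * m.reverse + C z * (X ^ 2 - 1) * numerPoly a m =
      m * (C (t⁻¹ * m.eval 0) * (X ^ 2 - 1) + C z * X ^ (m.natDegree % 2)) := by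
  obtain ⟨h, hh⟩ := exists_numer_eq z a hm hdvd
  suffices t⁻¹ * m.eval 0 = h by rwa [this]
  have hc := congrArg (coeff · (m.natDegree + 2)) hh
  have h1 : m.reverse.coeff (m.natDegree + 2) = 0 :=
    coeff_eq_zero_of_natDegree_lt (by have := m.reverse_natDegree_le; omega)
  have h2 : (numerPoly a m).coeff (m.natDegree + 2) = 0 :=
    coeff_eq_zero_of_natDegree_lt (by have := natDegree_numerPoly_le a m; omega)
  have h3 : m.coeff (m.natDegree + 2) = 0 := coeff_eq_zero_of_natDegree_lt (by omega)
  have h4 : (m * X ^ (m.natDegree % 2)).coeff (m.natDegree + 2) = 0 :=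
    coeff_eq_zero_of_natDegree_lt (by
      have h5 := natDegree_mul_le (p := m) (q := X ^ (m.natDegree % 2))
      rw [natDegree_X_pow] at h5
      omega)
  have h5 : m.reverse.coeff m.natDegree = m.eval 0 := by
    rw [coeff_reverse, revAt_le le_rfl, Nat.sub_self, coeff_zero_eq_eval_zero]
  have e1 : (C t⁻¹ * (X ^ 2 - 1) + C z) * m.reverse + C z * (X ^ 2 - 1) * numerPoly a m =
      C t⁻¹ * (m.reverse * X ^ 2) + C (z - t⁻¹) * m.reverse + C z * (numerPoly a m * X ^ 2) -
        C z * numerPoly a m := by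
    rw [C_sub]; ring
  have e2 : m * (C h * (X ^ 2 - 1) + C z * X ^ (m.natDegree % 2)) =
      C h * (m * X ^ 2) - C h * m + C z * (m * X ^ (m.natDegree % 2)) := by ring
  simp only [e1, e2, coeff_add, coeff_sub, coeff_C_mul, coeff_mul_X_pow, h1, h2, h3, h4, h5,
    coeff_numerPoly_natDegree, hm.coeff_natDegree] at hc
  linear_combination hc

theorem reverse_numerPoly (a : ℤ → k) (m : k[X]) : reflect m.natDegree (numerPoly a m) =
    ∑ i ∈ range (m.natDegree + 1), ∑ j ∈ range i, C (m.coeff i * a j) * X ^ (i - j) := by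
  have h : numerPoly a m = ∑ x ∈ (range (m.natDegree + 1)).sigma range,
      C (m.coeff x.1 * a x.2) * X ^ (m.natDegree - x.1 + x.2) := by
    rw [sum_sigma, numerPoly]
    refine sum_congr rfl fun i _ => ?_
    rw [mul_sum]
    refine sum_congr rfl fun j _ => ?_
    rw [C_mul, pow_add]; ring
  rw [h, reflect_sum_C_mul_X_pow, sum_sigma]
  refine sum_congr rfl fun i hi => sum_congr rfl fun j hj => ?_
  rw [mem_range] at hi hj
  rw [revAt_le (by dsimp only; omega)]
  congr 2
  dsimp only
  omega

/-- This is `numer_eq` with coefficients reversed in degree `d + 2`, each product splitting as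
degree 2 times degree `d`. It serves the left series. -/
theorem numer_reflect_eq {z t : k} {a : ℤ → k} {m : k[X]} (hm : m.Monic)
    (hdvd : m ∣ curlSum z t a m) :
    (C t⁻¹ * (1 - X ^ 2) + C z * X ^ 2) * m +
        C z * (1 - X ^ 2) * reflect m.natDegree (numerPoly a m) =
      m.reverse * (C (t⁻¹ * m.eval 0) * (1 - X ^ 2) + C z * X ^ (2 - m.natDegree % 2)) := by
  have h := congrArg (reflect (m.natDegree + 2)) (numer_eq hm hdvd)
  have h2 : ∀ c : k, reflect 2 (C c) = C c * X ^ 2 := fun c => by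
    rw [reflect_C]
  have hX : ∀ c : k, reflect 2 (C c * X ^ 2) = C c := fun c => by
    rw [reflect_C_mul_X_pow, revAt_le le_rfl, Nat.sub_self, pow_zero, mul_one]
  have hε : reflect 2 (C z * X ^ (m.natDegree % 2)) = C z * X ^ (2 - m.natDegree % 2) := by
    rw [reflect_C_mul_X_pow, revAt_le (by omega)]
  have e1 : C t⁻¹ * (X ^ 2 - 1) + C z = C t⁻¹ * X ^ 2 + C (z - t⁻¹) := by rw [C_sub]; ring
  have e2 : C z * (X ^ 2 - 1) = C z * X ^ 2 + C (-z) := by rw [C_neg]; ring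
  have e3 : ∀ c : k, C c * (X ^ 2 - 1) + C z * X ^ (m.natDegree % 2) =
      C c * X ^ 2 + C (-c) + C z * X ^ (m.natDegree % 2) := fun c => by rw [C_neg]; ring
  rw [e1, e2, e3, reflect_add, add_comm m.natDegree 2, reflect_mul _ _ (by compute_degree)
    m.reverse_natDegree_le, reflect_mul _ _ (by compute_degree) (natDegree_numerPoly_le a m),
    add_comm 2, reflect_mul _ _ le_rfl, reflect_add, reflect_add, reflect_add, reflect_add, h2, h2,
    h2, hX, hX, hX, hε] at h
  · have h3 : reflect m.natDegree m.reverse = m := by rw [reverse, reflect_reflect]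
    have h4 : reflect m.natDegree m = m.reverse := rfl
    rw [h3, h4, C_sub, C_neg, C_neg] at h
    linear_combination h
  · have := natDegree_C_mul_X_pow_le z (m.natDegree % 2)
    refine natDegree_add_le_of_degree_le (by compute_degree) (this.trans (by omega))

theorem mk_eq_sum_add (a : ℤ → k) (i : ℕ) : PowerSeries.mk (fun n : ℕ => a n) =
    ((∑ j ∈ range i, C (a j) * X ^ j : k[X]) : PowerSeries k) +
      PowerSeries.X ^ i * PowerSeries.mk (fun n : ℕ => a (i + n)) := by
  ext n
  rw [map_add, PowerSeries.coeff_mk, PowerSeries.coeff_X_pow_mul', coeff_coe, finsetSum_coeff]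
  simp only [coeff_C_mul_X_pow, sum_ite_eq, mem_range, PowerSeries.coeff_mk]
  split_ifs with h1 h2 h2
  · omega
  · rw [add_zero]
  · rw [zero_add, ← Nat.cast_add, Nat.add_sub_cancel' h2]
  · omega

/-- The subtracted terms remove the exponents `0, ..., i` from the shifted series. The exponent `i`
with coefficient `a 0` belongs to the left side, hence it is added back. -/
theorem X_pow_mul_mk_neg (a : ℤ → k) (i : ℕ) :
    PowerSeries.X ^ i * PowerSeries.mk (fun n : ℕ => a (-n)) =
      PowerSeries.mk (fun n : ℕ => a (i + -n)) - PowerSeries.C (a i) +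
        PowerSeries.C (a 0) * PowerSeries.X ^ i -
        ((∑ j ∈ range i, C (a j) * X ^ (i - j) : k[X]) : PowerSeries k) := by
  ext n
  rw [map_sub, map_add, map_sub, PowerSeries.coeff_mk, PowerSeries.coeff_X_pow_mul', coeff_coe,
    finsetSum_coeff, PowerSeries.coeff_C_mul_X_pow, PowerSeries.coeff_C]
  simp only [coeff_C_mul_X_pow, PowerSeries.coeff_mk]
  have h : ∑ j ∈ range i, (if n = i - j then a j else 0) =
      if 1 ≤ n ∧ n ≤ i then a (i + -n) else 0 := by
    split_ifs with hn
    · rw [sum_eq_single (i - n)]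
      · rw [if_pos (by omega), Nat.cast_sub hn.2, sub_eq_add_neg]
      · intro j hj hne
        rw [mem_range] at hj
        rw [if_neg (by omega)]
      · intro hi
        rw [mem_range] at hi
        omega
    · refine sum_eq_zero fun j hj => if_neg ?_
      rw [mem_range] at hj
      omega
  rw [h]
  rcases Nat.eq_zero_or_pos n with rfl | hn
  · rcases Nat.eq_zero_or_pos i with rfl | hi
    · simp
    · simp [hi.ne, hi.ne']
  · rcases lt_trichotomy n i with hlt | rfl | hlt
    · simp [hn.ne', hlt.ne, hlt.not_ge, hlt.le, Nat.one_le_iff_ne_zero]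
    · simp [hn.ne', Nat.one_le_iff_ne_zero]
    · simp [hn.ne', hlt.ne', hlt.not_ge, hlt.le, sub_eq_add_neg]

theorem sum_C_mul_mk_eq_zero {a : ℤ → k} {m : k[X]}
    (ha : ∀ n : ℤ, ∑ i ∈ range (m.natDegree + 1), m.coeff i * a (i + n) = 0) (g : ℕ → ℤ) :
    ∑ i ∈ range (m.natDegree + 1),
      PowerSeries.C (m.coeff i) * PowerSeries.mk (fun n : ℕ => a (i + g n)) = 0 := by
  ext n
  simpa [map_sum, PowerSeries.coeff_C_mul] using ha (g n)

/-- Each series is split after its first `i` terms. The initial segments assemble to `numerPoly`,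
and the tails cancel by the recurrence. -/
theorem reverse_mul_mk {a : ℤ → k} {m : k[X]}
    (ha : ∀ n : ℤ, ∑ i ∈ range (m.natDegree + 1), m.coeff i * a (i + n) = 0) :
    (m.reverse : PowerSeries k) * PowerSeries.mk (fun n : ℕ => a n) =
      (numerPoly a m : PowerSeries k) := by
  rw [← sub_eq_zero, ← mul_zero (PowerSeries.X ^ m.natDegree),
    ← sum_C_mul_mk_eq_zero ha (fun n => n), reverse_eq_sum, numerPoly]
  simp only [← coeToPowerSeries.ringHom_apply, map_sum, sum_mul, mul_sum]
  rw [← sum_sub_distrib]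
  refine sum_congr rfl fun i hi => ?_
  have hi' : PowerSeries.X ^ m.natDegree =
      (PowerSeries.X ^ (m.natDegree - i) * PowerSeries.X ^ i : PowerSeries k) := by
    rw [← pow_add, Nat.sub_add_cancel (Nat.lt_succ_iff.mp (mem_range.mp hi))]
  rw [← map_sum, ← mul_sum, hi', mk_eq_sum_add a i, map_mul]
  simp only [coeToPowerSeries.ringHom_apply, Polynomial.coe_mul, coe_C,
    Polynomial.coe_pow, coe_X]
  ring

/-- The same argument run towards negative indices. The recurrence at `n = 0` also disposes of the
constants `a i` produced by `X_pow_mul_mk_neg`. -/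
theorem mul_mk_neg {a : ℤ → k} {m : k[X]}
    (ha : ∀ n : ℤ, ∑ i ∈ range (m.natDegree + 1), m.coeff i * a (i + n) = 0) :
    (m : PowerSeries k) * PowerSeries.mk (fun n : ℕ => a (-n)) =
      PowerSeries.C (a 0) * m - (reflect m.natDegree (numerPoly a m) : k[X]) := by
  have h1 := sum_C_mul_mk_eq_zero ha (fun n => -n)
  have h2 : ∑ i ∈ range (m.natDegree + 1), (PowerSeries.C (m.coeff i) * PowerSeries.C (a i)) =
      (0 : PowerSeries k) := by
    simp only [← map_mul, ← map_sum]
    simpa using congrArg PowerSeries.C (ha 0)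
  have h3 : (m : PowerSeries k) =
      ∑ i ∈ range (m.natDegree + 1), PowerSeries.C (m.coeff i) * PowerSeries.X ^ i := by
    conv_lhs => rw [m.as_sum_range_C_mul_X_pow]
    simp only [← coeToPowerSeries.ringHom_apply, map_sum]
    simp
  have h4 : ((reflect m.natDegree (numerPoly a m) : k[X]) : PowerSeries k) =
      ∑ i ∈ range (m.natDegree + 1), PowerSeries.C (m.coeff i) *
        ((∑ j ∈ range i, C (a j) * X ^ (i - j) : k[X]) : PowerSeries k) := by
    rw [reverse_numerPoly]
    simp only [← coeToPowerSeries.ringHom_apply, map_sum, mul_sum]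
    simp [mul_assoc]
  rw [h4, h3, sum_mul, mul_sum, ← sub_eq_zero, ← sum_sub_distrib, ← sum_sub_distrib]
  rw [← sub_eq_zero.mpr (h1.trans h2.symm), ← sum_sub_distrib]
  refine sum_congr rfl fun i _ => ?_
  rw [mul_assoc, X_pow_mul_mk_neg]
  ring

/-- This is `numer_eq` at `u = 0`, where `numerPoly` takes the value `a 0`, known from the undotted
bubble. The power `0 ^ (d % 2)` treats both parities at once. -/
theorem neg_eq_eval_zero_mul {z t : k} {a : ℤ → k} {m : k[X]} (hm : m.Monic)
    (hdvd : m ∣ curlSum z t a m)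
    (ha : ∀ n : ℤ, ∑ i ∈ range (m.natDegree + 1), m.coeff i * a (i + n) = 0)
    (ha0 : z * a 0 = t - t⁻¹ + z) :
    -t = m.eval 0 * (-(t⁻¹ * m.eval 0) + z * 0 ^ (m.natDegree % 2)) := by
  have h := congrArg (eval 0) (numer_eq hm hdvd)
  have h1 : m.reverse.eval 0 = 1 := by
    rw [← coeff_zero_eq_eval_zero, coeff_zero_reverse, hm.leadingCoeff]
  have h2 : (numerPoly a m).eval 0 = a 0 := by
    have h3 := congrArg PowerSeries.constantCoeff (reverse_mul_mk ha)
    rw [map_mul, constantCoeff_coe, constantCoeff_coe, coeff_zero_eq_eval_zero, h1, one_mul,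
      coeff_zero_eq_eval_zero] at h3
    rw [← h3]
    simp [← PowerSeries.coeff_zero_eq_constantCoeff_apply]
  simp only [eval_add, eval_mul, eval_sub, eval_pow, eval_C, eval_X, eval_one, h1, h2] at h
  linear_combination h + ha0

end BubblePolynomials

/-! ### Rational functions, the substitution of `u⁻¹`, and expansion at infinity. -/

section Expansion

variable {k : Type u} [Field k]

theorem invVar_algebraMap (p : Polynomial k) :
    invVar (algebraMap (Polynomial k) (RatFunc k) p) =
      Polynomial.aeval (RatFunc.X⁻¹ : RatFunc k) p := by
  have h := RatFunc.liftAlgHom_apply_div (Polynomial.aeval (RatFunc.X⁻¹ : RatFunc k))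
    (nonZeroDivisors_le_comap_nonZeroDivisors_of_injective _
      (transcendental_iff_injective.mp transcendental_inv_X)) p 1
  rw [map_one, map_one, div_one, div_one] at h
  exact h

theorem invVar_X : invVar (RatFunc.X : RatFunc k) = RatFunc.X⁻¹ := by
  rw [← RatFunc.algebraMap_X, invVar_algebraMap, Polynomial.aeval_X, RatFunc.algebraMap_X]

theorem invVar_C (c : k) : invVar (RatFunc.C c) = RatFunc.C c := by
  rw [← RatFunc.algebraMap_C, invVar_algebraMap, Polynomial.aeval_C, RatFunc.algebraMap_C]
  rfl

theorem invVar_algebraMap_mul_X_pow (p : Polynomial k) :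
    invVar (algebraMap (Polynomial k) (RatFunc k) p) * RatFunc.X ^ p.natDegree =
      algebraMap (Polynomial k) (RatFunc k) p.reverse := by
  let : Invertible (RatFunc.X : RatFunc k) := invertibleOfNonzero RatFunc.X_ne_zero
  have h : ∀ q : Polynomial k, Polynomial.eval₂ (algebraMap k (RatFunc k)) RatFunc.X q =
      algebraMap (Polynomial k) (RatFunc k) q := fun q => by
    rw [← Polynomial.aeval_def, ← RatFunc.algebraMap_X, Polynomial.aeval_algebraMap_apply,
      Polynomial.aeval_X_left_apply]
  have h2 := Polynomial.eval₂_reflect_mul_pow (algebraMap k (RatFunc k)) RatFunc.X p.natDegree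
    p.reverse p.reverse_natDegree_le
  rw [Polynomial.reverse, Polynomial.reflect_reflect, invOf_eq_inv, h] at h2
  rw [invVar_algebraMap, Polynomial.aeval_def, h2, Polynomial.reverse]

theorem reverse_natDegree_of_eval_zero_ne {m : Polynomial k} (h0 : m.eval 0 ≠ 0) :
    m.reverse.natDegree = m.natDegree := by
  rw [Polynomial.reverse_natDegree, Polynomial.natTrailingDegree_eq_zero.mpr
    (Or.inr (by rwa [Polynomial.coeff_zero_eq_eval_zero])), Nat.sub_zero]

theorem reverse_reverse_of_eval_zero_ne {m : Polynomial k} (h0 : m.eval 0 ≠ 0) :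
    m.reverse.reverse = m := by
  rw [Polynomial.reverse, reverse_natDegree_of_eval_zero_ne h0, Polynomial.reverse,
    Polynomial.reflect_reflect]

open scoped RatFunc in
-- A series and a rational function agree once the same denominator carries both to the same
-- polynomial numerator.
theorem ofPowerSeries_eq_expandInfty {S : PowerSeries k} {F : RatFunc k} {N D : Polynomial k}
    (hD : D ≠ 0) (hS : S * (D : PowerSeries k) = (N : PowerSeries k))
    (hF : invVar F * algebraMap (Polynomial k) (RatFunc k) D =
      algebraMap (Polynomial k) (RatFunc k) N) :
    HahnSeries.ofPowerSeries ℤ k S = expandInfty F := by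
  have h1 := congrArg (algebraMap (RatFunc k) (LaurentSeries k)) hF
  have h2 := congrArg (HahnSeries.ofPowerSeries ℤ k) hS
  rw [map_mul] at h1 h2
  have hc : ∀ P : Polynomial k, HahnSeries.ofPowerSeries ℤ k (P : PowerSeries k) =
      algebraMap (RatFunc k) (LaurentSeries k) (algebraMap (Polynomial k) (RatFunc k) P) :=
    fun P => RatFunc.coe_coe P
  rw [hc, hc, ← h1] at h2
  refine mul_right_cancel₀ ?_ h2
  rw [Ne, map_eq_zero, map_eq_zero_iff _ (RatFunc.algebraMap_injective k)]
  exact hD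

theorem quadratic_ne_zero (z : k) :
    (1 - Polynomial.C z * Polynomial.X - Polynomial.X ^ 2 : Polynomial k) ≠ 0 := by
  intro h
  have := congrArg (Polynomial.eval 0) h
  simp at this

theorem ratFunc_quadratic_ne_zero (z : k) :
    (1 - RatFunc.C z * RatFunc.X - RatFunc.X ^ 2 : RatFunc k) ≠ 0 := by
  have h := (map_ne_zero_iff _ (RatFunc.algebraMap_injective k)).mpr (quadratic_ne_zero z)
  simpa only [map_sub, map_mul, map_pow, map_one, RatFunc.algebraMap_C, RatFunc.algebraMap_X]
    using h

variable {z t : kˣ} {m : Polynomial k}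

/-- In the variable `u` itself, `ratL` has exactly the numerator and denominator that `seriesR_mul`
finds in `u⁻¹`. The symmetry then identifies it with the substituted `ratR`. -/
theorem ratL_mul (h0 : m.eval 0 ≠ 0) :
    ratL z t m * algebraMap (Polynomial k) (RatFunc k) (m.reverse *
        (1 - Polynomial.C (z : k) * Polynomial.X - Polynomial.X ^ 2)) =
      algebraMap (Polynomial k) (RatFunc k) (-(m * (Polynomial.C ((t : k)⁻¹ * m.eval 0) *
        (Polynomial.X ^ 2 - 1) + Polynomial.C (z : k) * Polynomial.X ^ (m.natDegree % 2)))) := by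
  have hr : algebraMap (Polynomial k) (RatFunc k) m.reverse ≠ 0 := by
    rw [Ne, map_eq_zero_iff _ (RatFunc.algebraMap_injective k), Polynomial.reverse_eq_zero]
    rintro rfl
    simp at h0
  have hq : RatFunc.X ^ 2 + RatFunc.C (z : k) * RatFunc.X - 1 ≠ 0 := by
    have := neg_ne_zero.mpr (ratFunc_quadratic_ne_zero (z : k))
    convert this using 1
    ring
  have hM : RatFunc.C (m.eval 0) ≠ 0 := (map_ne_zero _).mpr h0
  have ht : RatFunc.C (t : k) ≠ 0 := (map_ne_zero _).mpr t.ne_zero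
  simp only [ratL, polyCheck, map_sub, map_add, map_neg, map_mul, map_pow, map_one, map_inv₀,
    RatFunc.algebraMap_C, RatFunc.algebraMap_X]
  have e : 1 - RatFunc.C (z : k) * RatFunc.X - RatFunc.X ^ 2 =
      -(RatFunc.X ^ 2 + RatFunc.C (z : k) * RatFunc.X - 1) := by ring
  rw [e]
  generalize RatFunc.X ^ 2 + RatFunc.C (z : k) * RatFunc.X - 1 = q at hq ⊢
  rcases Nat.mod_two_eq_zero_or_one m.natDegree with hd | hd
  · rw [if_pos (Nat.even_iff.mpr hd), hd]
    field_simp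
    ring
  · rw [if_neg (by rw [Nat.not_even_iff_odd]; exact Nat.odd_iff.mpr hd), hd]
    field_simp
    ring

theorem ratR_mul (h0 : m.eval 0 ≠ 0) :
    ratR z t m * algebraMap (Polynomial k) (RatFunc k) (m *
        (1 + Polynomial.C (z : k) * Polynomial.X - Polynomial.X ^ 2)) =
      algebraMap (Polynomial k) (RatFunc k) (m.reverse * (Polynomial.C ((t : k) * (m.eval 0)⁻¹) *
        (1 - Polynomial.X ^ 2) + Polynomial.C (z : k) * Polynomial.X ^ (m.natDegree % 2))) := by
  have hr : algebraMap (Polynomial k) (RatFunc k) m ≠ 0 := by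
    rw [Ne, map_eq_zero_iff _ (RatFunc.algebraMap_injective k)]
    rintro rfl
    simp at h0
  have hq : RatFunc.X ^ 2 - RatFunc.C (z : k) * RatFunc.X - 1 ≠ 0 := by
    have := neg_ne_zero.mpr (ratFunc_quadratic_ne_zero (-z : k))
    convert this using 1
    rw [map_neg]
    ring
  have hM : RatFunc.C (m.eval 0) ≠ 0 := (map_ne_zero _).mpr h0
  simp only [ratR, polyCheck, map_sub, map_add, map_mul, map_pow, map_one, map_inv₀,
    RatFunc.algebraMap_C, RatFunc.algebraMap_X]
  have e : 1 + RatFunc.C (z : k) * RatFunc.X - RatFunc.X ^ 2 =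
      -(RatFunc.X ^ 2 - RatFunc.C (z : k) * RatFunc.X - 1) := by ring
  rw [e]
  generalize RatFunc.X ^ 2 - RatFunc.C (z : k) * RatFunc.X - 1 = q at hq ⊢
  rcases Nat.mod_two_eq_zero_or_one m.natDegree with hd | hd
  · rw [if_pos (Nat.even_iff.mpr hd), hd]
    field_simp
    ring
  · rw [if_neg (by rw [Nat.not_even_iff_odd]; exact Nat.odd_iff.mpr hd), hd]
    field_simp
    ring

theorem X_sq_mul_inv_pow {ε : ℕ} (hε : ε ≤ 2) :
    (RatFunc.X : RatFunc k) ^ 2 * RatFunc.X⁻¹ ^ ε = RatFunc.X ^ (2 - ε) := by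
  rw [inv_pow, ← div_eq_mul_inv, pow_sub₀ _ RatFunc.X_ne_zero hε, div_eq_mul_inv]

/-- With denominators cleared, the two sides differ by terms that the constraint `hc` on `m(0)`
cancels. -/
theorem ratL_eq_invVar_ratR (h0 : m.eval 0 ≠ 0)
    (hc : -(t : k) = m.eval 0 * (-((t : k)⁻¹ * m.eval 0) + z * 0 ^ (m.natDegree % 2))) :
    ratL z t m = invVar (ratR z t m) := by
  have h := congrArg invVar (ratR_mul (z := z) (t := t) h0)
  have h' := ratL_mul (z := z) (t := t) h0
  have hm := invVar_algebraMap_mul_X_pow m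
  have hr := invVar_algebraMap_mul_X_pow m.reverse
  rw [reverse_natDegree_of_eval_zero_ne h0, reverse_reverse_of_eval_zero_ne h0] at hr
  have hε := X_sq_mul_inv_pow (k := k) (ε := m.natDegree % 2) (by omega)
  have hX2 := X_sq_mul_inv_pow (k := k) le_rfl
  have hX1 := X_sq_mul_inv_pow (k := k) one_le_two
  have hD : algebraMap (Polynomial k) (RatFunc k) (m.reverse *
      (1 - Polynomial.C (z : k) * Polynomial.X - Polynomial.X ^ 2)) ≠ 0 := by
    rw [Ne, map_eq_zero_iff _ (RatFunc.algebraMap_injective k), mul_eq_zero, not_or,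
      Polynomial.reverse_eq_zero]
    exact ⟨by rintro rfl; simp at h0, quadratic_ne_zero _⟩
  refine mul_right_cancel₀ hD ?_
  rw [h']
  -- Substituting `u⁻¹` changes `u ^ ε` into `u ^ (2 - ε)` after clearing `u²`. This is a change
  -- only for even degree, where `hc'` absorbs the resulting multiple of `u² - 1`.
  have hδ : (RatFunc.X : RatFunc k) ^ (2 - m.natDegree % 2) - RatFunc.X ^ (m.natDegree % 2) =
      RatFunc.C (0 ^ (m.natDegree % 2)) * (RatFunc.X ^ 2 - 1) := by
    rcases Nat.mod_two_eq_zero_or_one m.natDegree with hd | hd <;> rw [hd] <;> simp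
  have hc' : RatFunc.C (t * (m.eval 0)⁻¹) + RatFunc.C (z : k) * RatFunc.C (0 ^ (m.natDegree % 2)) =
      RatFunc.C ((t : k)⁻¹ * m.eval 0) := by
    rw [← map_mul, ← map_add]
    congr 1
    field_simp at hc ⊢
    linear_combination -hc
  rw [pow_one, show 2 - 1 = 1 from rfl, pow_one] at hX1
  rw [Nat.sub_self, pow_zero] at hX2
  simp only [map_sub, map_add, map_neg, map_mul, map_pow, map_one,
    RatFunc.algebraMap_C, RatFunc.algebraMap_X, invVar_X, invVar_C] at h hc' hδ ⊢
  generalize invVar (algebraMap (Polynomial k) (RatFunc k) m) = p at *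
  generalize invVar (algebraMap (Polynomial k) (RatFunc k) m.reverse) = r at *
  generalize algebraMap (Polynomial k) (RatFunc k) m = p' at *
  generalize algebraMap (Polynomial k) (RatFunc k) m.reverse = r' at *
  generalize invVar (ratR z t m) = F at *
  subst hm hr
  linear_combination (RatFunc.X ^ 2 * RatFunc.X ^ m.natDegree) * h
    - F * p * RatFunc.X ^ m.natDegree * (RatFunc.C (z : k) * hX1 - hX2)
    - r * RatFunc.X ^ m.natDegree * RatFunc.C (t : k) * RatFunc.C (m.eval 0)⁻¹ * hX2
    + r * RatFunc.X ^ m.natDegree * RatFunc.C (z : k) * (hε + hδ)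
    + r * RatFunc.X ^ m.natDegree * (RatFunc.X ^ 2 - 1) * hc'

theorem invVar_ratR_mul (h0 : m.eval 0 ≠ 0)
    (hc : -(t : k) = m.eval 0 * (-((t : k)⁻¹ * m.eval 0) + z * 0 ^ (m.natDegree % 2))) :
    invVar (ratR z t m) * algebraMap (Polynomial k) (RatFunc k) (m.reverse *
        (1 - Polynomial.C (z : k) * Polynomial.X - Polynomial.X ^ 2)) =
      algebraMap (Polynomial k) (RatFunc k) (-(m * (Polynomial.C ((t : k)⁻¹ * m.eval 0) *
        (Polynomial.X ^ 2 - 1) + Polynomial.C (z : k) * Polynomial.X ^ (m.natDegree % 2)))) := by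
  rw [← ratL_eq_invVar_ratR h0 hc, ratL_mul h0]

theorem invVar_ratL_mul (h0 : m.eval 0 ≠ 0) :
    invVar (ratL z t m) * algebraMap (Polynomial k) (RatFunc k) (m *
        (1 + Polynomial.C (z : k) * Polynomial.X - Polynomial.X ^ 2)) =
      algebraMap (Polynomial k) (RatFunc k) (m.reverse * (Polynomial.C ((t : k)⁻¹ * m.eval 0) *
        (1 - Polynomial.X ^ 2) +
          Polynomial.C (z : k) * Polynomial.X ^ (2 - m.natDegree % 2))) := by
  have h := congrArg invVar (ratL_mul (z := z) (t := t) h0)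
  have hm := invVar_algebraMap_mul_X_pow m
  have hr := invVar_algebraMap_mul_X_pow m.reverse
  rw [reverse_natDegree_of_eval_zero_ne h0, reverse_reverse_of_eval_zero_ne h0] at hr
  have hε := X_sq_mul_inv_pow (k := k) (ε := m.natDegree % 2) (by omega)
  have hX2 := X_sq_mul_inv_pow (k := k) le_rfl
  have hX1 := X_sq_mul_inv_pow (k := k) one_le_two
  rw [pow_one, show 2 - 1 = 1 from rfl, pow_one] at hX1
  rw [Nat.sub_self, pow_zero] at hX2
  simp only [map_sub, map_add, map_neg, map_mul, map_pow, map_one,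
    RatFunc.algebraMap_C, RatFunc.algebraMap_X, invVar_X, invVar_C] at h ⊢
  generalize invVar (algebraMap (Polynomial k) (RatFunc k) m) = p at *
  generalize invVar (algebraMap (Polynomial k) (RatFunc k) m.reverse) = r at *
  generalize algebraMap (Polynomial k) (RatFunc k) m = p' at *
  generalize algebraMap (Polynomial k) (RatFunc k) m.reverse = r' at *
  subst hm hr
  rw [← hε]
  linear_combination (-RatFunc.X ^ 2 * RatFunc.X ^ m.natDegree) * h
    - invVar (ratL z t m) * r * RatFunc.X ^ m.natDegree * (hX2 + RatFunc.C (z : k) * hX1)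
    + p * RatFunc.X ^ m.natDegree * RatFunc.C (t : k)⁻¹ * RatFunc.C (m.eval 0) * hX2

end Expansion

/-! ### The kernel of the dot homomorphism and its generator. -/

section Brick

open Polynomial Finset

variable {k : Type u} [Field k] {z t : kˣ} {R : Type w} [Category.{v} R]
  [Preadditive R] [Linear k R] {L : R}

theorem IsBrick.scalar_smul_one (hL : IsBrick k L) (f : End L) :
    hL.scalar f • (1 : End L) = f := by
  have h := (RingEquiv.ofBijective (algebraMap k (End L)) hL).apply_symm_apply f
  rw [← Algebra.algebraMap_eq_smul_one]
  exact h

theorem IsBrick.scalar_algebraMap (hL : IsBrick k L) (c : k) :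
    hL.scalar (algebraMap k (End L) c) = c :=
  (RingEquiv.ofBijective (algebraMap k (End L)) hL).symm_apply_apply c

theorem IsBrick.scalar_smul (hL : IsBrick k L) (c : k) (f : End L) :
    hL.scalar (c • f) = c * hL.scalar f := by
  rw [Algebra.smul_def, map_mul, hL.scalar_algebraMap]

variable [MonoidalLeftAction (AK z t) R]

theorem dotHom_toLaurent (p : k[X]) :
    dotHom z t L p.toLaurent = aeval (dotAct z t L : End (AK.go z t ⊙ₗ L)) p := by
  have h : (dotHom z t L).comp toLaurentAlg =
      aeval (dotAct z t L : End (AK.go z t ⊙ₗ L)) := by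
    refine Polynomial.algHom_ext ?_
    rw [AlgHom.comp_apply, toLaurentAlg_apply, toLaurent_X, aeval_X, LaurentPolynomial.T, dotHom]
    refine (AddMonoidAlgebra.lift_single _ _ _).trans ?_
    simp
  exact DFunLike.congr_fun h p

theorem mem_dotKernel_toLaurent (p : k[X]) : p.toLaurent ∈ dotKernel z t L ↔
    aeval (dotAct z t L : End (AK.go z t ⊙ₗ L)) p = 0 := by
  rw [dotKernel, RingHom.mem_ker, dotHom_toLaurent]

/-- A power of `X` clears the denominators of the Laurent quotient, and `m` is coprime to it. -/
theorem dvd_of_toLaurent_dvd {m p : k[X]} (hm : m.eval 0 ≠ 0)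
    (h : toLaurent m ∣ toLaurent p) : m ∣ p := by
  obtain ⟨g, hg⟩ := h
  obtain ⟨n, f, hf⟩ := g.exists_T_pow
  have h1 : X ^ n * p = m * f := by
    apply toLaurent_injective
    rw [map_mul, map_mul, toLaurent_X_pow, hf, hg, LaurentPolynomial.T_mul, mul_assoc]
  have hcop : IsCoprime m (X ^ n) := by
    refine IsCoprime.pow_right ?_
    rw [isCoprime_comm, (irreducible_X).coprime_iff_not_dvd, X_dvd_iff, coeff_zero_eq_eval_zero]
    exact hm
  exact hcop.dvd_of_dvd_mul_left ⟨f, h1⟩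

theorem IsDotMinPoly.dvd_iff {m : k[X]} (hm : IsDotMinPoly z t L m) (p : k[X]) :
    m ∣ p ↔ aeval (dotAct z t L : End (AK.go z t ⊙ₗ L)) p = 0 := by
  rw [← mem_dotKernel_toLaurent, hm.span_eq, Ideal.mem_span_singleton]
  exact ⟨map_dvd _, dvd_of_toLaurent_dvd hm.eval_zero_ne⟩

theorem IsDotMinPoly.unique {m m' : k[X]} (hm : IsDotMinPoly z t L m)
    (hm' : IsDotMinPoly z t L m') : m' = m := by
  refine eq_of_monic_of_associated hm'.monic hm.monic (associated_of_dvd_dvd ?_ ?_)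
  · rw [hm'.dvd_iff, ← hm.dvd_iff]
  · rw [hm.dvd_iff, ← hm'.dvd_iff]

theorem exists_isDotMinPoly (h : dotKernel z t L ≠ ⊥) : ∃ m : k[X], IsDotMinPoly z t L m := by
  set x : End (AK.go z t ⊙ₗ L) := ↑(dotAct z t L)
  -- Membership in the kernel is insensitive to the unit `T n`, so it can be tested on polynomials.
  have hmem : ∀ (g : LaurentPolynomial k) (n : ℕ) (f : k[X]),
      toLaurent f = g * LaurentPolynomial.T n → (g ∈ dotKernel z t L ↔ aeval x f = 0) := by
    intro g n f hf
    rw [← mem_dotKernel_toLaurent, hf]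
    refine ⟨fun hg => Ideal.mul_mem_right _ _ hg, fun hg => ?_⟩
    have := Ideal.mul_mem_right (LaurentPolynomial.T (-n)) _ hg
    rwa [LaurentPolynomial.mul_T_assoc, add_neg_cancel, LaurentPolynomial.T_zero, mul_one] at this
  have hint : IsIntegral k x := by
    obtain ⟨g, hg, hg0⟩ := Submodule.exists_mem_ne_zero_of_ne_bot h
    obtain ⟨n, f, hf⟩ := g.exists_T_pow
    refine IsAlgebraic.isIntegral ⟨f, ?_, (hmem g n f hf).mp hg⟩
    rintro rfl
    rw [map_zero, eq_comm, (LaurentPolynomial.isUnit_T n).mul_left_eq_zero] at hf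
    exact hg0 hf
  -- If `X` divided the minimal polynomial, the invertible `x` could be cancelled, leaving an
  -- annihilating polynomial of smaller degree.
  have heval : (minpoly k x).eval 0 ≠ 0 := by
    rw [← coeff_zero_eq_eval_zero, Ne, ← X_dvd_iff]
    rintro ⟨f, hf⟩
    have h1 : aeval x f = 0 := by
      have h2 := minpoly.aeval k x
      rw [hf, map_mul, aeval_X] at h2
      exact (dotAct z t L).isUnit.mul_right_eq_zero.mp h2
    have hf0 : f ≠ 0 := by
      rintro rfl
      rw [mul_zero] at hf
      exact minpoly.ne_zero hint hf
    have h3 := natDegree_le_of_dvd (minpoly.dvd k x h1) hf0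
    rw [hf, natDegree_X_mul hf0] at h3
    omega
  refine ⟨minpoly k x, minpoly.monic hint, heval, ?_⟩
  ext g
  obtain ⟨n, f, hf⟩ := g.exists_T_pow
  rw [hmem g n f hf, ← minpoly.dvd_iff, Ideal.mem_span_singleton]
  constructor
  · intro hd
    have h1 := map_dvd toLaurent hd
    rwa [hf, (LaurentPolynomial.isUnit_T n).dvd_mul_right] at h1
  · intro hd
    exact dvd_of_toLaurent_dvd heval (hf ▸ hd.mul_right _)

theorem dotKernel_ne_bot_of_finiteDimensional [FiniteDimensional k (End (AK.go z t ⊙ₗ L))] :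
    dotKernel z t L ≠ ⊥ := by
  obtain ⟨f, hf, hf0⟩ : IsAlgebraic k (dotAct z t L : End (AK.go z t ⊙ₗ L)) :=
    Algebra.IsAlgebraic.isAlgebraic _
  intro h
  have := (mem_dotKernel_toLaurent f).mpr hf0
  rw [h, Ideal.mem_bot, toLaurent_eq_zero] at this
  exact hf this

variable [IsLinearAction k (AK z t) R]

/-- Self-duality of `go`: bending the strand with a cup is injective, since bending it back with a
cap is a left inverse. -/
theorem finiteDimensional_end_go [FiniteDimensional k (L ⟶ AK.go z t ⊙ₗ AK.go z t ⊙ₗ L)] :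
    FiniteDimensional k (End (AK.go z t ⊙ₗ L)) := by
  let φ : End (AK.go z t ⊙ₗ L) →ₗ[k] (L ⟶ AK.go z t ⊙ₗ AK.go z t ⊙ₗ L) :=
    { toFun f := AK.cupAct z t L ≫ AK.go z t ⊴ₗ f
      map_add' f g := by rw [IsLinearAction.actionHomRight_add k, Preadditive.comp_add]
      map_smul' r f := by
        rw [IsLinearAction.actionHomRight_smul, Linear.comp_smul, RingHom.id_apply] }
  refine FiniteDimensional.of_injective φ ?_
  refine Function.LeftInverse.injective
    (g := fun h => AK.go z t ⊴ₗ h ≫ AK.capAct z t (AK.go z t ⊙ₗ L)) fun f => ?_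
  change AK.go z t ⊴ₗ (AK.cupAct z t L ≫ AK.go z t ⊴ₗ f) ≫ _ = f
  rw [actionHomRight_comp, Category.assoc, ← AK.capAct_naturality, AK.zigzag_capAct_assoc]

/-- The scalar by which the bubble with `n` dots acts on a brick. -/
noncomputable def bubbleScalar (hL : IsBrick k L) (n : ℤ) : k :=
  hL.scalar (AK.bubbleMap z t L ↑(dotAct z t L ^ n))

end Brick

/-! ### Bubble scalars of a brick and the two series. -/

section Series

open Polynomial Finset

variable {k : Type u} [Field k] {z t : kˣ} {R : Type w} [Category.{v} R]
  [Preadditive R] [Linear k R] {L : R}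
  [MonoidalLeftAction (AK z t) R] [IsLinearAction k (AK z t) R]

theorem bubbleMap_zpow (hL : IsBrick k L) (n : ℤ) :
    AK.bubbleMap z t L ↑(dotAct z t L ^ n) = bubbleScalar (z := z) (t := t) hL n • (1 : End L) :=
  (hL.scalar_smul_one _).symm

theorem mul_bubbleScalar_zero (hL : IsBrick k L) :
    (z : k) * bubbleScalar (z := z) (t := t) hL 0 = t - (t : k)⁻¹ + z := by
  have h : AK.bubbleMap z t L ↑(dotAct z t L ^ (0 : ℤ)) =
      (((t : k) - (t : k)⁻¹) * (z : k)⁻¹ + 1) • (1 : End L) := by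
    rw [zpow_zero]
    change AK.cupAct z t L ≫ AK.go z t ⊴ₗ 𝟙 _ ≫ AK.capAct z t L = _
    rw [actionHomRight_id, Category.id_comp, AK.cup_cap_act, End.one_def]
  rw [bubbleScalar, h, ← Algebra.algebraMap_eq_smul_one, hL.scalar_algebraMap, mul_add, mul_one,
    mul_left_comm, mul_inv_cancel₀ z.ne_zero, mul_one]

/-- Obtained by closing `m(x) x ^ n = 0` to a bubble; negative `n` are allowed because `x` is
invertible. -/
theorem sum_bubbleScalar (hL : IsBrick k L) {m : k[X]}
    (hm : aeval (dotAct z t L : End (AK.go z t ⊙ₗ L)) m = 0) (n : ℤ) :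
    ∑ i ∈ range (m.natDegree + 1), m.coeff i * bubbleScalar (z := z) (t := t) hL (i + n) = 0 := by
  have h1 : ∑ i ∈ range (m.natDegree + 1),
      m.coeff i • (↑(dotAct z t L ^ (i + n)) : End (AK.go z t ⊙ₗ L)) = 0 := by
    rw [aeval_eq_sum_range] at hm
    have := congrArg (· * (↑(dotAct z t L ^ n) : End (AK.go z t ⊙ₗ L))) hm
    simp only [sum_mul, zero_mul, smul_mul_assoc] at this
    rw [← this]
    refine sum_congr rfl fun i _ => ?_
    rw [zpow_add, Units.val_mul, zpow_natCast, Units.val_pow_eq_pow_val]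
  have h2 := congrArg (fun f => hL.scalar (AK.bubbleMap z t L f)) h1
  simp only [map_sum, map_smul, map_zero, hL.scalar_smul] at h2
  exact h2

/-- Induction on `n` with `curlMap_dot_mul`: the extra factor `x` cancels the `x⁻¹` left by the dot
that was pulled out. -/
theorem curlMap_pow_mul (hL : IsBrick k L) (n : ℕ) :
    AK.curlMap z t L ((dotAct z t L : End (AK.go z t ⊙ₗ L)) ^ n) *
        (dotAct z t L : End (AK.go z t ⊙ₗ L)) ^ n =
      aeval (dotAct z t L : End (AK.go z t ⊙ₗ L))
        (curlPoly (z : k) t (bubbleScalar (z := z) (t := t) hL) n) := by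
  induction n with
  | zero =>
    rw [pow_zero, AK.curlMap_one, curlPoly, range_zero, sum_empty, mul_zero, add_zero, mul_one,
      aeval_C, Algebra.algebraMap_eq_smul_one]
  | succ n ih =>
    have hb := bubbleMap_zpow (z := z) (t := t) hL n
    rw [zpow_natCast, Units.val_pow_eq_pow_val] at hb
    have hp : curlPoly (z : k) t (bubbleScalar (z := z) (t := t) hL) (n + 1) =
        curlPoly (z : k) t (bubbleScalar (z := z) (t := t) hL) n +
          C (z : k) * (C (bubbleScalar (z := z) (t := t) hL n) * X ^ n - X ^ (2 * n)) := by
      rw [curlPoly, sum_range_succ, curlPoly]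
      ring
    rw [hp, map_add, ← ih, pow_succ', AK.curlMap_dot_mul _ _ _ _ hb, mul_assoc,
      Units.inv_mul_cancel_left, add_mul, smul_mul_assoc, sub_mul, smul_mul_assoc, one_mul,
      ← pow_add, ← two_mul]
    simp only [map_mul, map_sub, aeval_C, map_pow, aeval_X, Algebra.smul_def]

/-- The value is the curl of `m(x)`, multiplied by `x ^ d` to clear all negative powers of the dot.
-/
theorem aeval_curlSum (hL : IsBrick k L) {m : k[X]}
    (hm : aeval (dotAct z t L : End (AK.go z t ⊙ₗ L)) m = 0) :
    aeval (dotAct z t L : End (AK.go z t ⊙ₗ L))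
      (curlSum (z : k) t (bubbleScalar (z := z) (t := t) hL) m) = 0 := by
  have h := congrArg (fun f => AK.curlMap z t L f *
    (dotAct z t L : End (AK.go z t ⊙ₗ L)) ^ m.natDegree) hm
  simp only [aeval_eq_sum_range, map_sum, map_smul, map_zero, zero_mul, sum_mul] at h
  rw [curlSum, map_sum, ← h]
  refine sum_congr rfl fun i hi => ?_
  obtain ⟨j, hj⟩ := Nat.exists_eq_add_of_le (Nat.lt_succ_iff.mp (mem_range.mp hi))
  have hp : ∀ p : k[X], C (m.coeff i) * X ^ (m.natDegree - i) * p =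
      C (m.coeff i) * (p * X ^ j) := fun p => by
    rw [hj, Nat.add_sub_cancel_left]
    ring
  rw [hp, map_mul, map_mul, ← curlMap_pow_mul, aeval_C, aeval_X_pow, ← Algebra.smul_def,
    mul_assoc, ← pow_add, ← hj, smul_mul_assoc]

/-- Only `k`-linearity and the value 1 at the identity are needed: one factor of the product of
series has scalar coefficients. -/
theorem scalar_unitAct_coeff (hL : IsBrick k L) (c d : PowerSeries k)
    (B : ℕ → End (𝟙_ (AK z t))) (n : ℕ) :
    hL.scalar (unitAct z t L (PowerSeries.coeff n
      (PowerSeries.map (algebraMap k (End (𝟙_ (AK z t)))) c +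
        PowerSeries.map (algebraMap k (End (𝟙_ (AK z t)))) d * PowerSeries.mk B))) =
    PowerSeries.coeff n (c + d * PowerSeries.mk fun i => hL.scalar (unitAct z t L (B i))) := by
  let φ : End (𝟙_ (AK z t)) →ₗ[k] k :=
    { toFun f := hL.scalar (unitAct z t L f)
      map_add' f g := by
        rw [unitAct, IsLinearAction.add_actionHomLeft k, Preadditive.add_comp,
          Preadditive.comp_add, map_add]
        rfl
      map_smul' r f := by
        rw [unitAct, IsLinearAction.smul_actionHomLeft, Linear.smul_comp, Linear.comp_smul,
          hL.scalar_smul]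
        rfl }
  have h1 : ∀ c : k, φ (algebraMap k _ c) = c := by
    intro c
    have : φ 1 = 1 := by
      change hL.scalar ((λₗ L).inv ≫ 𝟙 _ ⊵ₗ L ≫ (λₗ L).hom) = 1
      rw [id_actionHomLeft, Category.id_comp, Iso.inv_hom_id]
      exact map_one hL.scalar
    rw [Algebra.algebraMap_eq_smul_one, map_smul, this, smul_eq_mul, mul_one]
  change φ _ = _
  rw [map_add, map_add, map_add, PowerSeries.coeff_map, h1, PowerSeries.coeff_mul,
    PowerSeries.coeff_mul, map_sum]
  congr 1
  refine sum_congr rfl fun p _ => ?_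
  rw [PowerSeries.coeff_map, PowerSeries.coeff_mk, PowerSeries.coeff_mk, ← Algebra.smul_def,
    map_smul]
  rfl

open PowerSeries in
theorem seriesR_eq (hL : IsBrick k L) : seriesR z t hL =
    (PowerSeries.C ((t : k)⁻¹ - z) - PowerSeries.C (t : k)⁻¹ * PowerSeries.X ^ 2) *
        (1 - PowerSeries.C (z : k) * PowerSeries.X - PowerSeries.X ^ 2)⁻¹ +
      PowerSeries.C (z : k) * (1 - PowerSeries.X ^ 2) *
        (1 - PowerSeries.C (z : k) * PowerSeries.X - PowerSeries.X ^ 2)⁻¹ *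
          PowerSeries.mk fun n : ℕ => bubbleScalar (z := z) (t := t) hL n := by
  ext n
  rw [seriesR, PowerSeries.coeff_mk, bubbleGenR, scalar_unitAct_coeff]
  congr 4
  ext i
  rw [AK.unitAct_bubbleR, bubbleScalar, zpow_natCast, Units.val_pow_eq_pow_val]
  rfl

theorem seriesL_eq (hL : IsBrick k L) : seriesL z t hL =
    (PowerSeries.C ((t : k) + z) - PowerSeries.C (t : k) * PowerSeries.X ^ 2) *
        (1 + PowerSeries.C (z : k) * PowerSeries.X - PowerSeries.X ^ 2)⁻¹ -
      PowerSeries.C (z : k) * (1 - PowerSeries.X ^ 2) *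
        (1 + PowerSeries.C (z : k) * PowerSeries.X - PowerSeries.X ^ 2)⁻¹ *
          PowerSeries.mk fun n : ℕ => bubbleScalar (z := z) (t := t) hL (-n) := by
  ext n
  rw [seriesL, PowerSeries.coeff_mk, bubbleGenL, sub_eq_add_neg, ← neg_mul, ← map_neg,
    scalar_unitAct_coeff, neg_mul, ← sub_eq_add_neg]
  congr 4
  ext i
  rw [AK.unitAct_bubbleL, bubbleScalar, zpow_neg, zpow_natCast, ← inv_pow,
    Units.val_pow_eq_pow_val]
  rfl

/-- After multiplication by `m.reverse` the bubble series becomes `numerPoly`, and `numer_eq`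
removes the dependence on the bubbles. -/
theorem seriesR_mul (hL : IsBrick k L) {m : k[X]} (hm : IsDotMinPoly z t L m) :
    seriesR z t hL * ((m.reverse * (1 - C (z : k) * X - X ^ 2) : k[X]) : PowerSeries k) =
      (-(m * (C ((t : k)⁻¹ * m.eval 0) * (X ^ 2 - 1) +
        C (z : k) * X ^ (m.natDegree % 2))) : k[X]) := by
  have h0 := (hm.dvd_iff m).mp dvd_rfl
  have hW := congrArg coeToPowerSeries.ringHom
    (numer_eq hm.monic ((hm.dvd_iff _).mpr (aeval_curlSum hL h0)))
  have hN := reverse_mul_mk (sum_bubbleScalar hL h0)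
  have hq := PowerSeries.mul_inv_cancel
    (1 - PowerSeries.C (z : k) * PowerSeries.X - PowerSeries.X ^ 2) (by simp)
  rw [seriesR_eq]
  rw [← coeToPowerSeries.ringHom_apply, ← coeToPowerSeries.ringHom_apply]
  rw [← coeToPowerSeries.ringHom_apply, ← coeToPowerSeries.ringHom_apply] at hN
  simp only [map_mul, map_add, map_sub, map_neg, map_pow, map_one] at hW ⊢
  simp only [coeToPowerSeries.ringHom_apply, coe_C, coe_X] at hW hN hq ⊢
  rw [← hN] at hW
  linear_combination (((PowerSeries.C (t : k)⁻¹ - PowerSeries.C (z : k)) -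
    PowerSeries.C (t : k)⁻¹ * PowerSeries.X ^ 2 + PowerSeries.C (z : k) * (1 - PowerSeries.X ^ 2) *
      PowerSeries.mk fun n : ℕ => bubbleScalar (z := z) (t := t) hL n) *
        (m.reverse : PowerSeries k)) * hq - hW

/-- As for `seriesR_mul`, with `mul_mk_neg` and `numer_reflect_eq`. The extra term in `a 0` is
evaluated by `mul_bubbleScalar_zero`. -/
theorem seriesL_mul (hL : IsBrick k L) {m : k[X]} (hm : IsDotMinPoly z t L m) :
    seriesL z t hL * ((m * (1 + C (z : k) * X - X ^ 2) : k[X]) : PowerSeries k) =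
      (m.reverse * (C ((t : k)⁻¹ * m.eval 0) * (1 - X ^ 2) +
        C (z : k) * X ^ (2 - m.natDegree % 2)) : k[X]) := by
  have h0 := (hm.dvd_iff m).mp dvd_rfl
  have hW := congrArg coeToPowerSeries.ringHom
    (numer_reflect_eq hm.monic ((hm.dvd_iff _).mpr (aeval_curlSum hL h0)))
  have hN := mul_mk_neg (sum_bubbleScalar hL h0)
  have hq := PowerSeries.mul_inv_cancel
    (1 + PowerSeries.C (z : k) * PowerSeries.X - PowerSeries.X ^ 2) (by simp)
  have ha := congrArg PowerSeries.C (mul_bubbleScalar_zero (z := z) (t := t) hL)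
  rw [seriesL_eq]
  rw [← coeToPowerSeries.ringHom_apply, ← coeToPowerSeries.ringHom_apply]
  simp only [map_mul, map_add, map_sub, map_pow, map_one] at hW ha ⊢
  simp only [coeToPowerSeries.ringHom_apply, coe_C, coe_X] at hW ⊢
  linear_combination (((PowerSeries.C (t : k) + PowerSeries.C (z : k)) -
    PowerSeries.C (t : k) * PowerSeries.X ^ 2 - PowerSeries.C (z : k) * (1 - PowerSeries.X ^ 2) *
      PowerSeries.mk fun n : ℕ => bubbleScalar (z := z) (t := t) hL (-n)) *
        (m : PowerSeries k)) * hq - (PowerSeries.C (z : k) * (1 - PowerSeries.X ^ 2)) * hN + hW -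
    (1 - PowerSeries.X ^ 2) * (m : PowerSeries k) * ha

end Series

theorem theorem5p6 {k : Type u} [Field k] (z t : kˣ)
    {R : Type w} [Category.{v} R] [Preadditive R] [Linear k R]
    [MonoidalLeftAction (AK z t) R] [IsLinearAction k (AK z t) R]
    (L : R) (hL : IsBrick k L) :
    (((∀ V : R, FiniteDimensional k (L ⟶ V)) ∨ FiniteDimensional k (End (AK.go z t ⊙ₗ L))) →
        dotKernel z t L ≠ ⊥) ∧
    (dotKernel z t L ≠ ⊥ → ∃! m : Polynomial k, IsDotMinPoly z t L m) ∧
    ∀ m : Polynomial k, IsDotMinPoly z t L m →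
      HahnSeries.ofPowerSeries ℤ k (seriesR z t hL) = expandInfty (ratR z t m) ∧
      HahnSeries.ofPowerSeries ℤ k (seriesL z t hL) = expandInfty (ratL z t m) ∧
      ratL z t m = invVar (ratR z t m) ∧
      (Even m.natDegree → (z : k) = (t : k)⁻¹ * m.eval 0 - t * (m.eval 0)⁻¹) ∧
      (Odd m.natDegree → m.eval 0 = t ∨ m.eval 0 = -(t : k)) := by
  refine ⟨?_, fun h => ?_, fun m hm => ?_⟩
  · rintro (h | h)
    · have := h (AK.go z t ⊙ₗ AK.go z t ⊙ₗ L)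
      have := finiteDimensional_end_go (k := k) (z := z) (t := t) (L := L)
      exact dotKernel_ne_bot_of_finiteDimensional
    · exact dotKernel_ne_bot_of_finiteDimensional
  · obtain ⟨m, hm⟩ := exists_isDotMinPoly h
    exact ⟨m, hm, fun m' hm' => hm.unique hm'⟩
  · have h0 := (hm.dvd_iff m).mp dvd_rfl
    have hc := neg_eq_eval_zero_mul hm.monic ((hm.dvd_iff _).mpr (aeval_curlSum hL h0))
      (sum_bubbleScalar hL h0) (mul_bubbleScalar_zero hL)
    have hM := hm.eval_zero_ne
    have ht : (t : k) ≠ 0 := t.ne_zero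
    have hq : (1 + Polynomial.C (z : k) * Polynomial.X - Polynomial.X ^ 2 : Polynomial k) ≠ 0 := by
      simpa using quadratic_ne_zero (-z : k)
    refine ⟨ofPowerSeries_eq_expandInfty ?_ (seriesR_mul hL hm) (invVar_ratR_mul hM hc),
      ofPowerSeries_eq_expandInfty ?_ (seriesL_mul hL hm) (invVar_ratL_mul hM),
      ratL_eq_invVar_ratR hM hc, fun hd => ?_, fun hd => ?_⟩
    · exact mul_ne_zero (Polynomial.reverse_eq_zero.not.mpr hm.monic.ne_zero) (quadratic_ne_zero _)
    · exact mul_ne_zero hm.monic.ne_zero hq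
    · rw [Nat.even_iff.mp hd, pow_zero] at hc
      field_simp at hc ⊢
      linear_combination -hc
    · rw [Nat.odd_iff.mp hd, pow_one, mul_zero, add_zero] at hc
      rw [← sq_eq_sq_iff_eq_or_eq_neg]
      field_simp at hc
      linear_combination hc
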